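/- **Setting.** A *discrete measurable groupoid* is a groupoid $\mathcal H$ (set of arrows; objects $\mathcal H^0\subset\mathcal H$ identified with the identity arrows; source and range $\mathfrak s,\mathfrak r:\mathcal H\to\mathcal H^0$; $fg$ is defined iff $\mathfrak s(f)=\mathfrak r(g)$) with a standard Borel structure such that $\mathcal H^0$, the set of composable pairs and the structure maps are Borel and all sets $\mathfrak s^{-1}(x),\mathfrak r^{-1}(x)$ are countable. It is *pmp* with respect to a Borel probability measure $\nu$ on $\mathcal H^0$ if $\int|\mathfrak s^{-1}(x)\cap B|\,d\nu(x)=\int|\mathfrak r^{-1}(x)\cap B|\,d\nu(x)$ for all Borel $B\subset\mathcal H$; this common value is also written $\nu(B)$. Let $[[\mathcal H]]$ be the set of Borel $f\subset\mathcal H$ on which $\mathfrak s$ and $\mathfrak r$ restrict to Borel isomorphisms onto their images, with product $fg=\{f'g': f'\in f,\ g'\in g \text{ composable}\}$, and $\mathrm{tr}_{\mathcal H}(f)=\nu(\mathcal H^0\cap f)$. For $d\in\mathbb N$ let $\Delta_d=\{1,\dots,d\}^2$ be the full groupoid ($\mathfrak s(i,j)=(j,j)$, $\mathfrak r(i,j)=(i,i)$,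 $(i,j)(j,k)=(i,k)$), $[[d]]=[[\Delta_d]]$, $|E|_d=|E|/d$ and $\mathrm{tr}_d(f)=|f\cap\Delta_d^0|_d$. A *sofic approximation* to $(\mathcal H,\nu)$ is a family $\mathbb P=\{\mathbb P_j\}_{j\in J}$ indexed by a directed set $J$, with $\mathbb P_j$ a probability measure on the set of all maps $[[\mathcal H]]\to[[d_j]]$ (with the $\sigma$-algebra generated by the cylinder sets), such that for all finite $F\subset[[\mathcal H]]$ and $\delta>0$: (1) $\mathbb P_j\{\sigma:|\mathrm{tr}_{d_j}(\sigma(s))-\mathrm{tr}_{\mathcal H}(s)|<\delta\ \forall s\in F\}\to1$; (2) for all sufficiently large $j$, for $\mathbb P_j$-almost every $\sigma$, $|\sigma(st)\,\Delta\,\sigma(s)\sigma(t)|_{d_j}<\delta$ for all $s,t\in F$; (3) $d_j\to\infty$; (4) if $f,f'\in[[\mathcal H]]$ and $\nu(f\Delta f')=0$ then, for every $j$, $\sigma(f)=\sigma(f')$ for $\mathbb P_j$-a.e. $\sigma$. A *bias* $\beta$ for $J$ is $-$, $+$, or an ultrafilter on $J$ containing every $\{j':j'\ge j\}$; $\lim_{j\to\beta}$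 is correspondingly the $\liminf$, the $\limsup$ or the ultralimit, in $[-\infty,\infty]$. Let $\pi:(\mathcal G,\mu)\to(\mathcal H,\nu)$ be a *pmp class-bijective extension* of discrete pmp groupoids: a surjective Borel groupoid morphism with $\pi_*\mu=\nu$ that maps $\mathfrak s^{-1}(a)$ bijectively onto $\mathfrak s^{-1}(\pi(a))$ and $\mathfrak r^{-1}(a)$ bijectively onto $\mathfrak r^{-1}(\pi(a))$ for every $a\in\mathcal G^0$. For $f\in[[\mathcal H]]$ and $P\subset\mathcal G^0$ put $f\cdot P=\{\mathfrak r(g):g\in\pi^{-1}(f),\ \mathfrak s(g)\in P\}$; for $f\in[[d]]$ and $A\subset\Delta_d^0$ put $f\cdot A=\{\mathfrak r(g):g\in f,\ \mathfrak s(g)\in A\}$. **Entropy.** Let $\mathcal P$ be a finite Borel partition of $\mathcal G^0$, $F\subset[[\mathcal H]]$ finite with $\mathcal H^0\in F$, $\delta>0$ and $\sigma:[[\mathcal H]]\to[[d]]$. Let $\mathcal P^F$ be the coarsest partition of $\mathcal G^0$ for which every $f\cdot P$ ($f\in F$, $P\in\mathcal P$) is a union of cells, and let $\Sigma(\cdot)$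 denote the algebra of sets generated by a finite partition. Let $\mathrm{Hom}(\pi,\sigma,\mathcal P,F,\delta)$ be the set of maps $\phi$ from $\Sigma(\mathcal P^F)$ to the subsets of $\Delta_d^0$ that preserve $\cup$, $\cap$, $\emptyset$ and the whole space and satisfy $$\sum_{P\in\mathcal P}|\sigma(f)\cdot\phi(P)\,\Delta\,\phi(f\cdot P)|_d<\delta\quad\forall f\in F,\qquad \sum_{P\in\mathcal P^F}\bigl||\phi(P)|_d-\mu(P)\bigr|<\delta .$$ If $\mathcal P$ refines the partition $\mathcal Q$ (written $\mathcal Q\le\mathcal P$), let $|\mathrm{Hom}(\pi,\sigma,\mathcal P,F,\delta)|_{\mathcal Q}$ be the number of distinct restrictions to $\Sigma(\mathcal Q)$ of elements of $\mathrm{Hom}(\pi,\sigma,\mathcal P,F,\delta)$. Fix $p\in[1,\infty]$ and a bias $\beta$. For an algebra of sets $\mathcal F\subset\mathcal B(\mathcal G^0)$ define $$h_{\mathbb P,\mu}(\pi,\mathcal F)=\sup_{\mathcal Q\subset\mathcal F}\ \inf_{\mathcal Q\le\mathcal P\subset\mathcal F}\ \inf_{F}\ \inf_{\delta>0}\ \lim_{j\to\beta}\frac1{d_j}\log\bigl\|\,|\mathrm{Hom}(\pi,\cdot,\mathcal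 P,F,\delta)|_{\mathcal Q}\bigr\|_{L^p(\mathbb P_j)}\in[-\infty,\infty],$$ where $\mathcal Q,\mathcal P$ range over finite partitions with all cells in $\mathcal F$, $F$ ranges over finite subsets of $[[\mathcal H]]$ containing $\mathcal H^0$, and $\log 0=-\infty$. Put $h_{\mathbb P,\mu}(\pi)=h_{\mathbb P,\mu}(\pi,\mathcal B(\mathcal G^0))$. The algebra $\mathcal F\subset\mathcal B(\mathcal G^0)$ is *$\pi$-generating* if every Borel subset of $\mathcal G^0$ agrees, up to a $\mu$-null set, with an element of the smallest $\sigma$-algebra containing all $f\cdot P$ with $f\in[[\mathcal H]]$ and $P\in\mathcal F$. **Theorem 7.5.** Let $\pi:(\mathcal G,\mu)\to(\mathcal H,\nu)$ be a pmp class-bijective extension of discrete pmp groupoids, $\mathbb P$ a sofic approximation to $(\mathcal H,\nu)$, $p\in[1,\infty]$ and $\beta$ a bias. If $\mathcal F\subset\mathcal B(\mathcal G^0)$ is a $\pi$-generating sub-algebra, then $h_{\mathbb P,\mu}(\pi)=h_{\mathbb P,\mu}(\pi,\mathcal F)$. In particular $h_{\mathbb P,\mu}(\pi,\mathcal F)$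 is the same for every $\pi$-generating sub-algebra $\mathcal F$. -/

import Mathlib

open Set MeasureTheory Filter Topology
open scoped ENNReal symmDiff

noncomputable section

namespace SoficEntropy

/-! ### Groupoids, as sets of arrows with the objects identified with the identity arrows -/

/-- A groupoid with set of arrows `H`; `units` is the set of identity arrows (objects).
The product `f g` is defined when `src f = rng g`. -/
class ArrowGroupoid (H : Type*) where
  units : Set H
  src : H → units
  rng : H → units
  comp : ∀ f g : H, src f = rng g → H
  inv : H → H
  src_unit : ∀ x : units, src (x : H) = x
  rng_unit : ∀ x : units, rng (x : H) = x
  src_comp : ∀ (f g : H) (h : src f = rng g), src (comp f g h) = src g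
  rng_comp : ∀ (f g : H) (h : src f = rng g), rng (comp f g h) = rng f
  comp_assoc : ∀ (f g k : H) (h₁ : src f = rng g) (h₂ : src g = rng k),
    comp (comp f g h₁) k ((src_comp f g h₁).trans h₂) =
      comp f (comp g k h₂) (h₁.trans (rng_comp g k h₂).symm)
  comp_unit : ∀ f : H, comp f (src f) (rng_unit (src f)).symm = f
  unit_comp : ∀ f : H, comp (rng f) f (src_unit (rng f)) = f
  src_inv : ∀ f : H, src (inv f) = rng f
  rng_inv : ∀ f : H, rng (inv f) = src f
  inv_comp : ∀ f : H, comp (inv f) f (src_inv f) = src f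
  comp_inv : ∀ f : H, comp f (inv f) (rng_inv f).symm = rng f

/-- The space of objects `H⁰` of a groupoid `H`. -/
abbrev UnitSpace (H : Type*) [ArrowGroupoid H] : Type _ := (ArrowGroupoid.units : Set H)

/-- The source map. -/
abbrev src {H : Type*} [ArrowGroupoid H] (f : H) : UnitSpace H := ArrowGroupoid.src f

/-- The range map. -/
abbrev rng {H : Type*} [ArrowGroupoid H] (f : H) : UnitSpace H := ArrowGroupoid.rng f

/-- A measurable groupoid: a groupoid on a standard Borel space, with Borel set of units, Borel set
of composable pairs and Borel structure maps. -/
class MeasurableGroupoid (H : Type*) [MeasurableSpace H] extends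
    ArrowGroupoid H, StandardBorelSpace H where
  measurableSet_units : MeasurableSet units
  measurableSet_composable : MeasurableSet {p : H × H | src p.1 = rng p.2}
  measurable_src : Measurable src
  measurable_rng : Measurable rng
  measurable_comp : Measurable fun p : {p : H × H // src p.1 = rng p.2} => comp p.1.1 p.1.2 p.2
  measurable_inv : Measurable inv

/-- A discrete measurable groupoid: all source and range fibres are countable. -/
class DiscreteMeasurableGroupoid (H : Type*) [MeasurableSpace H] extends
    MeasurableGroupoid H where
  countable_src : ∀ x : units, (src ⁻¹' {x}).Countable
  countable_rng : ∀ x : units, (rng ⁻¹' {x}).Countable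

/-- `ν_𝔰(B) = ∫ |𝔰⁻¹(x) ∩ B| dν(x)`. -/
def srcMass {H : Type*} [MeasurableSpace H] [ArrowGroupoid H]
    (ν : Measure (UnitSpace H)) (B : Set H) : ℝ≥0∞ :=
  ∫⁻ x, ((src ⁻¹' {x} ∩ B).encard : ℝ≥0∞) ∂ν

/-- `ν_𝔯(B) = ∫ |𝔯⁻¹(x) ∩ B| dν(x)`. -/
def rngMass {H : Type*} [MeasurableSpace H] [ArrowGroupoid H]
    (ν : Measure (UnitSpace H)) (B : Set H) : ℝ≥0∞ :=
  ∫⁻ x, ((rng ⁻¹' {x} ∩ B).encard : ℝ≥0∞) ∂ν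

/-- `(H, ν)` is probability-measure-preserving: `ν` is a probability measure on `H⁰` and the
measures `ν_𝔰` and `ν_𝔯` agree on Borel sets. -/
structure IsPMP {H : Type*} [MeasurableSpace H] [ArrowGroupoid H]
    (ν : Measure (UnitSpace H)) : Prop where
  isProbabilityMeasure : IsProbabilityMeasure ν
  srcMass_eq_rngMass : ∀ B : Set H, MeasurableSet B → srcMass ν B = rngMass ν B

/-! ### Partial automorphisms -/

/-- `f ⊆ H` is Borel and source and range restricted to `f` are Borel isomorphisms onto their
images. -/
structure IsPartialAut {H : Type*} [MeasurableSpace H] [ArrowGroupoid H] (f : Set H) : Prop where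
  measurableSet : MeasurableSet f
  src_embedding : MeasurableEmbedding (f.domRestrict src)
  rng_embedding : MeasurableEmbedding (f.domRestrict rng)

/-- On a standard Borel space injectivity of source and range is enough. -/
theorem isPartialAut_iff {H : Type*} [MeasurableSpace H] [MeasurableGroupoid H] {f : Set H} :
    IsPartialAut f ↔ MeasurableSet f ∧ InjOn src f ∧ InjOn rng f := by
  constructor
  · rintro ⟨h, h₁, h₂⟩
    exact ⟨h, injOn_iff_injective.2 h₁.injective, injOn_iff_injective.2 h₂.injective⟩
  · rintro ⟨h, h₁, h₂⟩
    have : StandardBorelSpace f := h.standardBorel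
    have : StandardBorelSpace (UnitSpace H) :=
      (MeasurableGroupoid.measurableSet_units (H := H)).standardBorel
    exact ⟨h,
      (MeasurableGroupoid.measurable_src.comp measurable_subtype_coe).measurableEmbedding
        (injOn_iff_injective.1 h₁),
      (MeasurableGroupoid.measurable_rng.comp measurable_subtype_coe).measurableEmbedding
        (injOn_iff_injective.1 h₂)⟩

/-- The pointwise product of two sets of arrows. -/
def setComp {H : Type*} [ArrowGroupoid H] (s t : Set H) : Set H :=
  {h | ∃ a ∈ s, ∃ b ∈ t, ∃ hab : src a = rng b, ArrowGroupoid.comp a b hab = h}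

theorem IsPartialAut.setComp {H : Type*} [MeasurableSpace H] [MeasurableGroupoid H]
    {s t : Set H} (hs : IsPartialAut s) (ht : IsPartialAut t) : IsPartialAut (setComp s t) := by
  rw [isPartialAut_iff] at hs ht ⊢
  obtain ⟨hs, hs₁, hs₂⟩ := hs
  obtain ⟨ht, ht₁, ht₂⟩ := ht
  have key₁ : ∀ a ∈ s, ∀ b ∈ t, ∀ hab : src a = rng b, ∀ a' ∈ s, ∀ b' ∈ t,
      ∀ hab' : src a' = rng b', src b = src b' → a = a' ∧ b = b' := by
    intro a ha b hb hab a' ha' b' hb' hab' h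
    have hbb := ht₁ hb hb' h
    subst hbb
    exact ⟨hs₁ ha ha' (hab.trans hab'.symm), rfl⟩
  have key₂ : ∀ a ∈ s, ∀ b ∈ t, ∀ hab : src a = rng b, ∀ a' ∈ s, ∀ b' ∈ t,
      ∀ hab' : src a' = rng b', rng a = rng a' → a = a' ∧ b = b' := by
    intro a ha b hb hab a' ha' b' hb' hab' h
    have haa := hs₂ ha ha' h
    subst haa
    exact ⟨rfl, ht₂ hb hb' (hab.symm.trans hab')⟩
  refine ⟨?_, ?_, ?_⟩
  · have hstd : StandardBorelSpace {p : H × H // src p.1 = rng p.2} :=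
      (MeasurableGroupoid.measurableSet_composable (H := H)).standardBorel
    let D : Set {p : H × H // src p.1 = rng p.2} := {p | p.1.1 ∈ s ∧ p.1.2 ∈ t}
    have hD : MeasurableSet D := by
      have h := (hs.prod ht).preimage
        (measurable_subtype_coe : Measurable
          (Subtype.val : {p : H × H // src p.1 = rng p.2} → H × H))
      exact h
    have himg : SoficEntropy.setComp s t =
        (fun p : {p : H × H // src p.1 = rng p.2} => ArrowGroupoid.comp p.1.1 p.1.2 p.2) '' D := by
      ext h
      constructor
      · rintro ⟨a, ha, b, hb, hab, rfl⟩
        exact ⟨⟨(a, b), hab⟩, ⟨ha, hb⟩, rfl⟩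
      · rintro ⟨⟨⟨a, b⟩, hab⟩, ⟨ha, hb⟩, rfl⟩
        exact ⟨a, ha, b, hb, hab, rfl⟩
    rw [himg]
    refine hD.image_of_measurable_injOn MeasurableGroupoid.measurable_comp ?_
    rintro ⟨⟨a, b⟩, hab⟩ ⟨ha, hb⟩ ⟨⟨a', b'⟩, hab'⟩ ⟨ha', hb'⟩ h
    have h' := congrArg src h
    simp only [ArrowGroupoid.src_comp] at h'
    obtain ⟨rfl, rfl⟩ := key₁ a ha b hb hab a' ha' b' hb' hab' h'
    rfl
  · rintro _ ⟨a, ha, b, hb, hab, rfl⟩ _ ⟨a', ha', b', hb', hab', rfl⟩ h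
    simp only [ArrowGroupoid.src_comp] at h
    obtain ⟨rfl, rfl⟩ := key₁ a ha b hb hab a' ha' b' hb' hab' h
    rfl
  · rintro _ ⟨a, ha, b, hb, hab, rfl⟩ _ ⟨a', ha', b', hb', hab', rfl⟩ h
    simp only [ArrowGroupoid.rng_comp] at h
    obtain ⟨rfl, rfl⟩ := key₂ a ha b hb hab a' ha' b' hb' hab' h
    rfl

theorem isPartialAut_units {H : Type*} [MeasurableSpace H] [MeasurableGroupoid H] :
    IsPartialAut (ArrowGroupoid.units : Set H) := by
  rw [isPartialAut_iff]
  refine ⟨MeasurableGroupoid.measurableSet_units, ?_, ?_⟩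
  · intro x hx y hy h
    have hx' := ArrowGroupoid.src_unit (H := H) ⟨x, hx⟩
    have hy' := ArrowGroupoid.src_unit (H := H) ⟨y, hy⟩
    exact congrArg Subtype.val (hx'.symm.trans (h.trans hy'))
  · intro x hx y hy h
    have hx' := ArrowGroupoid.rng_unit (H := H) ⟨x, hx⟩
    have hy' := ArrowGroupoid.rng_unit (H := H) ⟨y, hy⟩
    exact congrArg Subtype.val (hx'.symm.trans (h.trans hy'))

/-- The inverse semigroup `⟦H⟧` of partial automorphisms of a measurable groupoid. -/
@[ext] structure PartialAut (H : Type*) [MeasurableSpace H] [MeasurableGroupoid H] where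
  carrier : Set H
  isPartialAut : IsPartialAut carrier

/-- Composition in `⟦H⟧`. -/
instance {H : Type*} [MeasurableSpace H] [MeasurableGroupoid H] : Mul (PartialAut H) :=
  ⟨fun s t => ⟨setComp s.carrier t.carrier, s.isPartialAut.setComp t.isPartialAut⟩⟩

/-- `1 ∈ ⟦H⟧` is the unit space `H⁰`. -/
instance {H : Type*} [MeasurableSpace H] [MeasurableGroupoid H] : One (PartialAut H) :=
  ⟨⟨ArrowGroupoid.units, isPartialAut_units⟩⟩

/-- The trace `tr_H(f) = ν(H⁰ ∩ f)`. -/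
def trace {H : Type*} [MeasurableSpace H] [MeasurableGroupoid H]
    (ν : Measure (UnitSpace H)) (f : PartialAut H) : ℝ :=
  ν.real {x | (x : H) ∈ f.carrier}

/-- For a set `f` of arrows and a set `P` of objects, `f · P = 𝔯(fP)`. -/
def setAct {H : Type*} [ArrowGroupoid H] (f : Set H) (P : Set (UnitSpace H)) :
    Set (UnitSpace H) :=
  rng '' (f ∩ src ⁻¹' P)

/-! ### The full groupoid on `d` points -/

/-- The full groupoid `Δ_d` on `d` points. -/
abbrev FullGroupoid (d : ℕ) : Type := Fin d × Fin d

instance (d : ℕ) : MeasurableGroupoid (FullGroupoid d) where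
  units := {p | p.1 = p.2}
  src p := ⟨(p.2, p.2), rfl⟩
  rng p := ⟨(p.1, p.1), rfl⟩
  comp p q _ := (p.1, q.2)
  inv p := (p.2, p.1)
  src_unit := by rintro ⟨⟨i, j⟩, h⟩; cases h; rfl
  rng_unit := by rintro ⟨⟨i, j⟩, h⟩; cases h; rfl
  src_comp _ _ _ := rfl
  rng_comp _ _ _ := rfl
  comp_assoc _ _ _ _ _ := rfl
  comp_unit _ := rfl
  unit_comp _ := rfl
  src_inv _ := rfl
  rng_inv _ := rfl
  inv_comp _ := rfl
  comp_inv _ := rfl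
  measurableSet_units := MeasurableSet.of_discrete
  measurableSet_composable := MeasurableSet.of_discrete
  measurable_src := Measurable.of_discrete
  measurable_rng := Measurable.of_discrete
  measurable_comp := Measurable.of_discrete
  measurable_inv := Measurable.of_discrete

/-- `|A|_d = |A| / d`. -/
def normCard {X : Type*} (d : ℕ) (A : Set X) : ℝ := (A.ncard : ℝ) / d

/-- `tr_d(f) = |f ∩ Δ_d⁰| / d`. -/
def traceFin {d : ℕ} (f : PartialAut (FullGroupoid d)) : ℝ :=
  normCard d (f.carrier ∩ ArrowGroupoid.units)

/-- The finite set `⟦d⟧` carries the discrete Borel structure. -/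
instance (d : ℕ) : MeasurableSpace (PartialAut (FullGroupoid d)) := ⊤

/-- `Map(⟦H⟧, ⟦d⟧)`; its Borel structure is the product one, generated by the cylinder sets. -/
abbrev SoficMap (H : Type*) [MeasurableSpace H] [MeasurableGroupoid H] (d : ℕ) : Type _ :=
  PartialAut H → PartialAut (FullGroupoid d)

/-! ### Sofic approximations -/

/-- `(F, δ)`-multiplicative maps. -/
def IsMultiplicative {H : Type*} [MeasurableSpace H] [MeasurableGroupoid H] {d : ℕ}
    (F : Finset (PartialAut H)) (δ : ℝ) (σ : SoficMap H d) : Prop :=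
  ∀ s ∈ F, ∀ t ∈ F, normCard d ((σ (s * t)).carrier ∆ (σ s * σ t).carrier) < δ

/-- `(F, δ)`-trace-preserving maps. -/
def IsTracePreserving {H : Type*} [MeasurableSpace H] [MeasurableGroupoid H] {d : ℕ}
    (ν : Measure (UnitSpace H)) (F : Finset (PartialAut H)) (δ : ℝ) (σ : SoficMap H d) : Prop :=
  ∀ s ∈ F, |traceFin (σ s) - trace ν s| < δ

/-- `ℙ = (ℙ_j)_{j ∈ J}` is a sofic approximation to `(H, ν)`. -/
structure IsSoficApproximation {H : Type*} [MeasurableSpace H] [MeasurableGroupoid H]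
    (ν : Measure (UnitSpace H)) {J : Type*} [Preorder J] (d : J → ℕ)
    (ℙ : ∀ j, Measure (SoficMap H (d j))) : Prop where
  isProbabilityMeasure : ∀ j, IsProbabilityMeasure (ℙ j)
  tracePreserving : ∀ (F : Finset (PartialAut H)) (δ : ℝ), 0 < δ →
    Tendsto (fun j => ℙ j {σ | IsTracePreserving ν F δ σ}) atTop (𝓝 1)
  multiplicative : ∀ (F : Finset (PartialAut H)) (δ : ℝ), 0 < δ →
    ∃ j, ∀ j', j ≤ j' → ∀ᵐ σ ∂ℙ j', IsMultiplicative F δ σ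
  tendsto_size : Tendsto d atTop atTop
  ae_eq : ∀ f f' : PartialAut H, srcMass ν (f.carrier ∆ f'.carrier) = 0 →
    ∀ j, ∀ᵐ σ ∂ℙ j, σ f = σ f'

/-! ### Class-bijective extensions -/

/-- A (Borel) morphism of measurable groupoids. -/
structure IsGroupoidMorphism {G H : Type*} [MeasurableSpace G] [ArrowGroupoid G]
    [MeasurableSpace H] [ArrowGroupoid H] (π : G → H) : Prop where
  measurable : Measurable π
  map_unit : ∀ x : UnitSpace G, π x ∈ (ArrowGroupoid.units : Set H)
  map_comp : ∀ (f g : G) (h : src f = rng g), ∃ h' : src (π f) = rng (π g),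
    π (ArrowGroupoid.comp f g h) = ArrowGroupoid.comp (π f) (π g) h'
  map_inv : ∀ f : G, π (ArrowGroupoid.inv f) = ArrowGroupoid.inv (π f)

/-- `π : (G, μ) → (H, ν)` is a pmp class-bijective extension. -/
structure IsPMPClassBijectiveExtension {G H : Type*} [MeasurableSpace G] [ArrowGroupoid G]
    [MeasurableSpace H] [ArrowGroupoid H] (π : G → H)
    (μ : Measure (UnitSpace G)) (ν : Measure (UnitSpace H)) : Prop
    extends IsGroupoidMorphism π where
  bijOn_src : ∀ a : UnitSpace G, BijOn π (src ⁻¹' {a}) (src ⁻¹' {⟨π a, map_unit a⟩})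
  bijOn_rng : ∀ a : UnitSpace G, BijOn π (rng ⁻¹' {a}) (rng ⁻¹' {⟨π a, map_unit a⟩})
  surjective : Function.Surjective π
  isPMP_left : IsPMP μ
  isPMP_right : IsPMP ν
  map_measure : μ.map (fun a : UnitSpace G => (⟨π a, map_unit a⟩ : UnitSpace H)) = ν

/-- For `f ∈ ⟦H⟧` and `P ⊆ G⁰`, `f · P = 𝔯(π⁻¹(f) P)`. -/
def act {G H : Type*} [ArrowGroupoid G] [MeasurableSpace H] [MeasurableGroupoid H] (π : G → H)
    (f : PartialAut H) (P : Set (UnitSpace G)) : Set (UnitSpace G) :=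
  setAct (π ⁻¹' f.carrier) P

/-! ### Finite partitions

A finite partition of `X` is a `Finpartition (univ : Set X)`. In Mathlib's order `P ≤ Q` says that
`P` refines `Q` (which is written the other way round in entropy theory). -/

/-- `Σ(P)`: the (sigma-)algebra of sets generated by a finite partition `P`. -/
def sigmaSets {X : Type*} (P : Finpartition (univ : Set X)) : Set (Set X) :=
  {A | MeasurableSet[MeasurableSpace.generateFrom (P.parts : Set (Set X))] A}

open scoped Classical in
/-- The coarsest partition for which all the members of a finite family `S` are unions of cells:
two points are in the same cell if and only if they belong to the same members of `S`. -/
def generatedPartition {X : Type*} (S : Finset (Set X)) : Finpartition (univ : Set X) :=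
  Finpartition.ofErase (S.powerset.image fun T => {x | ∀ A ∈ S, x ∈ A ↔ A ∈ T})
    (by
      rw [Finset.supIndep_iff_pairwiseDisjoint]
      intro B hB C hC hBC
      simp only [Finset.coe_image, Set.mem_image, Finset.mem_coe, Finset.mem_powerset] at hB hC
      obtain ⟨T, hT, rfl⟩ := hB
      obtain ⟨U, hU, rfl⟩ := hC
      refine Set.disjoint_left.2 fun x hx hx' => hBC ?_
      have hTU : T = U := by
        ext A
        exact ⟨fun h => (hx' A (hT h)).1 ((hx A (hT h)).2 h),
          fun h => (hx A (hU h)).1 ((hx' A (hU h)).2 h)⟩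
      rw [hTU])
    (by
      refine Set.eq_univ_of_forall fun x => ?_
      rw [Finset.sup_id_set_eq_sUnion]
      refine Set.mem_sUnion.2 ⟨_, Finset.mem_coe.2 (Finset.mem_image.2
        ⟨S.filter fun A => x ∈ A, Finset.mem_powerset.2 (Finset.filter_subset _ _), rfl⟩), ?_⟩
      intro A hA
      simp [hA])

theorem mem_parts_generatedPartition {X : Type*} {S : Finset (Set X)} {C : Set X} :
    C ∈ (generatedPartition S).parts ↔ ∃ x, C = {y | ∀ A ∈ S, y ∈ A ↔ x ∈ A} := by
  classical
  simp only [generatedPartition, Finpartition.ofErase, Finset.mem_erase, Finset.mem_image,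
    Finset.mem_powerset]
  constructor
  · rintro ⟨hne, T, hT, rfl⟩
    obtain ⟨x, hx⟩ := Set.nonempty_iff_ne_empty.2 hne
    exact ⟨x, Set.ext fun y => forall₂_congr fun A hA => by rw [hx A hA]⟩
  · rintro ⟨x, rfl⟩
    refine ⟨Set.nonempty_iff_ne_empty.1 ⟨x, fun A _ => Iff.rfl⟩, S.filter fun A => x ∈ A,
      Finset.filter_subset _ _, Set.ext fun y => forall₂_congr fun A hA => ?_⟩
    simp [hA]

open scoped Classical in
/-- `P^F`: the coarsest partition for which all `f · A`, with `f ∈ F` and `A ∈ P`, are unions of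
cells. -/
def translatedPartition {G H : Type*} [ArrowGroupoid G] [MeasurableSpace H]
    [MeasurableGroupoid H] (π : G → H) (P : Finpartition (univ : Set (UnitSpace G)))
    (F : Finset (PartialAut H)) : Finpartition (univ : Set (UnitSpace G)) :=
  generatedPartition ((F ×ˢ P.parts).image fun q => act π q.1 q.2)

/-! ### Good homomorphisms -/

/-- `φ`, restricted to the algebra of sets `𝒮`, is a homomorphism to the algebra of all subsets
of `Y`. The values of `φ` outside `𝒮` are ignored. -/
structure IsHomOn {X Y : Type*} (𝒮 : Set (Set X)) (φ : Set X → Set Y) : Prop where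
  map_union : ∀ A ∈ 𝒮, ∀ B ∈ 𝒮, φ (A ∪ B) = φ A ∪ φ B
  map_inter : ∀ A ∈ 𝒮, ∀ B ∈ 𝒮, φ (A ∩ B) = φ A ∩ φ B
  map_empty : φ ∅ = ∅
  map_univ : φ univ = univ

/-- `φ ∈ Hom(π, σ, P, F, δ)`, for `φ` seen as a function on `Σ(P^F)`. -/
structure IsGoodHom {G H : Type*} [MeasurableSpace G] [ArrowGroupoid G] [MeasurableSpace H]
    [MeasurableGroupoid H] (π : G → H) (μ : Measure (UnitSpace G)) {d : ℕ} (σ : SoficMap H d)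
    (P : Finpartition (univ : Set (UnitSpace G))) (F : Finset (PartialAut H)) (δ : ℝ)
    (φ : Set (UnitSpace G) → Set (UnitSpace (FullGroupoid d))) : Prop where
  isHomOn : IsHomOn (sigmaSets (translatedPartition π P F)) φ
  equivariant : ∀ f ∈ F,
    ∑ A ∈ P.parts, normCard d (setAct (σ f).carrier (φ A) ∆ φ (act π f A)) < δ
  measure : ∑ A ∈ (translatedPartition π P F).parts, |normCard d (φ A) - μ.real A| < δ

/-- `|Hom(π, σ, P, F, δ)|_Q`: the number of maps `Σ(Q) → 𝓑(Δ_d⁰)` which are restrictions of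
elements of `Hom(π, σ, P, F, δ)`. -/
def homCount {G H : Type*} [MeasurableSpace G] [ArrowGroupoid G] [MeasurableSpace H]
    [MeasurableGroupoid H] (π : G → H) (μ : Measure (UnitSpace G)) {d : ℕ}
    (Q P : Finpartition (univ : Set (UnitSpace G))) (F : Finset (PartialAut H)) (δ : ℝ)
    (σ : SoficMap H d) : ℝ≥0∞ :=
  (((sigmaSets Q).domRestrict '' {φ | IsGoodHom π μ σ P F δ φ}).encard : ℝ≥0∞)

/-! ### Bias and entropy -/

/-- A bias for a directed set `J`: `-`, `+`, or an ultrafilter on `J` containing all tails. -/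
inductive Bias (J : Type*) [Preorder J] where
  | minus : Bias J
  | plus : Bias J
  | ultra (β : Ultrafilter J) (hβ : ∀ j : J, {j' | j ≤ j'} ∈ β) : Bias J

/-- The limit of `Φ` along a bias: lower limit, upper limit, or ultralimit, in the extended
reals. -/
def Bias.lim {J : Type*} [Preorder J] : Bias J → (J → EReal) → EReal
  | .minus, Φ => liminf Φ atTop
  | .plus, Φ => limsup Φ atTop
  | .ultra β _, Φ => (β.map Φ).lim

/-- The algebra `𝓑(X)` of all Borel sets. -/
def borelSets (X : Type*) [MeasurableSpace X] : Set (Set X) := {A | MeasurableSet A}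

section Entropy

variable {G H : Type*} [MeasurableSpace G] [ArrowGroupoid G] [MeasurableSpace H]
  [MeasurableGroupoid H] {J : Type*} [Preorder J] (d : J → ℕ)
  (ℙ : ∀ j, Measure (SoficMap H (d j))) (p : ℝ≥0∞) (β : Bias J)
  (π : G → H) (μ : Measure (UnitSpace G))

/-- `h(π, Q, P, F, δ) = lim_{j → β} (1 / d_j) log ‖ |Hom(π, ·, P, F, δ)|_Q ‖_{p, ℙ_j}`. -/
def entropyFinite (Q P : Finpartition (univ : Set (UnitSpace G)))
    (F : Finset (PartialAut H)) (δ : ℝ) : EReal :=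
  β.lim fun j => ENNReal.log (eLpNorm (homCount π μ (d := d j) Q P F δ) p (ℙ j)) / (d j : EReal)

/-- `h(π, Q, P)`. -/
def entropyPartitions (Q P : Finpartition (univ : Set (UnitSpace G))) : EReal :=
  ⨅ (F : Finset (PartialAut H)) (_ : 1 ∈ F) (δ : ℝ) (_ : 0 < δ),
    entropyFinite d ℙ p β π μ Q P F δ

/-- `h(π, Q, 𝓕)`: infimum over the finite partitions `P ⊆ 𝓕` which refine `Q`. -/
def entropyPartition (Q : Finpartition (univ : Set (UnitSpace G)))
    (𝓕 : Set (Set (UnitSpace G))) : EReal :=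
  ⨅ (P : Finpartition (univ : Set (UnitSpace G))) (_ : P ≤ Q)
    (_ : (P.parts : Set (Set (UnitSpace G))) ⊆ 𝓕), entropyPartitions d ℙ p β π μ Q P

/-- `h(π, 𝓕)`: supremum over the finite partitions `Q ⊆ 𝓕`. -/
def entropyAlgebra (𝓕 : Set (Set (UnitSpace G))) : EReal :=
  ⨆ (Q : Finpartition (univ : Set (UnitSpace G)))
    (_ : (Q.parts : Set (Set (UnitSpace G))) ⊆ 𝓕), entropyPartition d ℙ p β π μ Q 𝓕

/-- The sofic measure entropy `h(π) = h(π, 𝓑(G⁰))`. -/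
def entropy : EReal := entropyAlgebra d ℙ p β π μ (borelSets (UnitSpace G))

end Entropy

/-- `Σ_π(𝓕)`: the smallest sigma-algebra containing all `f · P` with `f ∈ ⟦H⟧` and `P ∈ 𝓕`. -/
abbrev generatedSigmaAlgebra {G H : Type*} [ArrowGroupoid G] [MeasurableSpace H]
    [MeasurableGroupoid H] (π : G → H) (𝓕 : Set (Set (UnitSpace G))) :
    MeasurableSpace (UnitSpace G) :=
  MeasurableSpace.generateFrom {B | ∃ f : PartialAut H, ∃ P ∈ 𝓕, B = act π f P}

/-- `𝓕` is a `π`-generating sub-algebra of `𝓑(G⁰)`: up to null sets, every Borel set belongs to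
`Σ_π(𝓕)`. -/
structure IsGenerating {G H : Type*} [MeasurableSpace G] [ArrowGroupoid G] [MeasurableSpace H]
    [MeasurableGroupoid H] (π : G → H) (μ : Measure (UnitSpace G))
    (𝓕 : Set (Set (UnitSpace G))) : Prop where
  isSetAlgebra : IsSetAlgebra 𝓕
  subset_borel : 𝓕 ⊆ borelSets (UnitSpace G)
  generates : ∀ B : Set (UnitSpace G), MeasurableSet B →
    ∃ A, MeasurableSet[generatedSigmaAlgebra π 𝓕] A ∧ μ (A ∆ B) = 0

end SoficEntropy

end

namespace SoficEntropy

/-! ### Algebras of sets generated by finite partitions -/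

section Partitions

variable {X Y : Type*}

/-! Two comparisons between counts of good homomorphisms, valid for every sufficiently
multiplicative σ, give the two inequalities.

Changing the inner partition (`IsGenerating.exists_homCount_le`). As 𝓕 generates, the finitely many
sets f·A with f ∈ F, A ∈ P are close in measure to members of Σ(P'^K) for some P' ⊂ 𝓕. Collapse each
cell of P'^K to a well-chosen point of that cell. The resulting point map τ fixes the sets of
Σ(P'^K) under preimage and moves those of Σ(P^F) only by small measure. So if φ is good for P', then
φ ∘ τ⁻¹ is good for P, with the same restriction to Σ(Q) when P' refines Q. Restrictions for P' are
thus among those for P, and the infimum over partitions in 𝓕 is at most the Borel one.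

Changing the outer partition (`homCount_le_exp_mul`). A Borel Q is approximated by Σ(Q'^K) with Q' ⊂
𝓕. By near equivariance, the restriction of a good homomorphism to Σ(Q') determines that to Σ(Q) up
to a small Hamming distance. Small Hamming balls have at most exp(κd) elements, so this costs an
arbitrarily small κ in the exponential rate. The first comparison, applied to the Borel algebra
itself, supplies a common Borel refinement P of Q and Q'.

Homomorphisms on finite algebras come from point maps (`IsHomOn.exists_eq_preimage`), so each
estimate says where a point can lie outside a small exceptional set. -/

theorem exists_mem_parts (P : Finpartition (univ : Set X)) (x : X) : ∃ C ∈ P.parts, x ∈ C := by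
  have h := P.sup_parts
  rw [Finset.sup_id_set_eq_sUnion] at h
  have hx : x ∈ ⋃₀ (P.parts : Set (Set X)) := by rw [h]; trivial
  simpa using hx

theorem eq_of_mem_parts {P : Finpartition (univ : Set X)} {C D : Set X} (hC : C ∈ P.parts)
    (hD : D ∈ P.parts) {x : X} (hxC : x ∈ C) (hxD : x ∈ D) : C = D := by
  by_contra hne
  exact Set.disjoint_left.1 (P.disjoint hC hD hne) hxC hxD

theorem mem_sigmaSets_of_mem_parts {P : Finpartition (univ : Set X)} {C : Set X}
    (hC : C ∈ P.parts) : C ∈ sigmaSets P :=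
  MeasurableSpace.measurableSet_generateFrom hC

theorem compl_mem_sigmaSets {P : Finpartition (univ : Set X)} {A : Set X}
    (hA : A ∈ sigmaSets P) : Aᶜ ∈ sigmaSets P :=
  MeasurableSet.compl (m := MeasurableSpace.generateFrom (P.parts : Set (Set X))) hA

theorem union_mem_sigmaSets {P : Finpartition (univ : Set X)} {A B : Set X}
    (hA : A ∈ sigmaSets P) (hB : B ∈ sigmaSets P) : A ∪ B ∈ sigmaSets P :=
  MeasurableSet.union (m := MeasurableSpace.generateFrom (P.parts : Set (Set X))) hA hB

theorem symmDiff_mem_sigmaSets {P : Finpartition (univ : Set X)} {A B : Set X}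
    (hA : A ∈ sigmaSets P) (hB : B ∈ sigmaSets P) : A ∆ B ∈ sigmaSets P :=
  MeasurableSet.symmDiff (m := MeasurableSpace.generateFrom (P.parts : Set (Set X))) hA hB

theorem univ_mem_sigmaSets (P : Finpartition (univ : Set X)) : univ ∈ sigmaSets P :=
  @MeasurableSet.univ _ (MeasurableSpace.generateFrom (P.parts : Set (Set X)))

/-- The working form of Σ(P): saturation for the cells passes through the σ-algebra operations, and
conversely a saturated set is the union of the finitely many cells inside it. -/
theorem mem_sigmaSets_iff {P : Finpartition (univ : Set X)} {A : Set X} :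
    A ∈ sigmaSets P ↔ ∀ C ∈ P.parts, ∀ x ∈ C, ∀ y ∈ C, x ∈ A → y ∈ A := by
  constructor
  · intro hA
    -- The induction carries an equivalence, since complements reverse the implication.
    have : ∀ C ∈ P.parts, ∀ x ∈ C, ∀ y ∈ C, x ∈ A ↔ y ∈ A := by
      refine MeasurableSpace.generateFrom_induction (P.parts : Set (Set X))
        (fun A _ => ∀ C ∈ P.parts, ∀ x ∈ C, ∀ y ∈ C, x ∈ A ↔ y ∈ A) ?_ ?_ ?_ ?_ A hA
      · intro D hD _ C hC x hx y hy
        constructor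
        · intro h
          rwa [eq_of_mem_parts hD hC h hx]
        · intro h
          rwa [eq_of_mem_parts hD hC h hy]
      · simp
      · intro B _ ih C hC x hx y hy
        simpa using not_congr (ih C hC x hx y hy)
      · intro s _ ih C hC x hx y hy
        simp only [mem_iUnion]
        exact exists_congr fun n => ih n C hC x hx y hy
    exact fun C hC x hx y hy => (this C hC x hx y hy).1
  · intro h
    have hA : A = ⋃ C ∈ {C ∈ (P.parts : Set (Set X)) | C ⊆ A}, C := by
      ext x
      simp only [mem_iUnion, mem_ofPred_eq, exists_prop]
      constructor
      · intro hx
        obtain ⟨C, hC, hxC⟩ := exists_mem_parts P x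
        exact ⟨C, ⟨hC, fun y hy => h C hC x hxC y hy hx⟩, hxC⟩
      · rintro ⟨C, ⟨-, hCA⟩, hxC⟩
        exact hCA hxC
    have hfin : {C ∈ (P.parts : Set (Set X)) | C ⊆ A}.Finite :=
      P.parts.finite_toSet.subset fun C hC => hC.1
    have hmeas : (⋃ C ∈ {C ∈ (P.parts : Set (Set X)) | C ⊆ A}, C) ∈ sigmaSets P := @MeasurableSet.biUnion _ _ (MeasurableSpace.generateFrom (P.parts : Set (Set X))) _ _
      hfin.countable fun C hC => MeasurableSpace.measurableSet_generateFrom hC.1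
    rwa [hA]

theorem finite_sigmaSets (P : Finpartition (univ : Set X)) : (sigmaSets P).Finite := by
  refine Set.Finite.of_finite_image (f := fun A => {C ∈ (P.parts : Set (Set X)) | C ⊆ A})
    (P.parts.finite_toSet.finite_subsets.subset ?_) ?_
  · rintro _ ⟨A, -, rfl⟩ C hC
    exact hC.1
  · have key : ∀ A ∈ sigmaSets P, ∀ B : Set X, {C ∈ (P.parts : Set (Set X)) | C ⊆ A} ⊆
        {C ∈ (P.parts : Set (Set X)) | C ⊆ B} → A ⊆ B := by
      intro A hA B h x hx
      obtain ⟨C, hC, hxC⟩ := exists_mem_parts P x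
      exact (h ⟨hC, fun y hy => mem_sigmaSets_iff.1 hA C hC x hxC y hy hx⟩).2 hxC
    intro A hA B hB h
    exact (key A hA B h.subset).antisymm (key B hB A h.superset)

theorem mem_sigmaSets_generatedPartition {S : Finset (Set X)} {A : Set X} :
    A ∈ sigmaSets (generatedPartition S) ↔
      ∀ x y, (∀ B ∈ S, x ∈ B ↔ y ∈ B) → x ∈ A → y ∈ A := by
  rw [mem_sigmaSets_iff]
  constructor
  · intro h x y hxy hx
    exact h _ (mem_parts_generatedPartition.2 ⟨x, rfl⟩) x (fun B _ => Iff.rfl) y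
      (fun B hB => (hxy B hB).symm) hx
  · intro h C hC x hx y hy hxA
    obtain ⟨z, rfl⟩ := mem_parts_generatedPartition.1 hC
    exact h x y (fun B hB => (hx B hB).trans (hy B hB).symm) hxA

theorem mem_sigmaSets_of_le {P Q : Finpartition (univ : Set X)} (h : P ≤ Q) {A : Set X}
    (hA : A ∈ sigmaSets Q) : A ∈ sigmaSets P := by
  rw [mem_sigmaSets_iff] at hA ⊢
  intro C hC x hx y hy hxA
  obtain ⟨D, hD, hCD⟩ := h hC
  exact hA D hD x (hCD hx) y (hCD hy) hxA

theorem generatedPartition_le {S : Finset (Set X)} {Q : Finpartition (univ : Set X)}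
    (h : Q.parts ⊆ S) : generatedPartition S ≤ Q := by
  intro C hC
  obtain ⟨x, rfl⟩ := mem_parts_generatedPartition.1 hC
  obtain ⟨D, hD, hxD⟩ := exists_mem_parts Q x
  exact ⟨D, hD, fun y hy => (hy D (h hD)).2 hxD⟩

theorem parts_generatedPartition_subset {𝓕 : Set (Set X)} (h𝓕 : IsSetAlgebra 𝓕)
    {S : Finset (Set X)} (hS : (S : Set (Set X)) ⊆ 𝓕) :
    ((generatedPartition S).parts : Set (Set X)) ⊆ 𝓕 := by
  classical
  intro C hC
  obtain ⟨x, rfl⟩ := mem_parts_generatedPartition.1 hC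
  have : {y | ∀ A ∈ S, y ∈ A ↔ x ∈ A} = ⋂ A ∈ S, if x ∈ A then A else Aᶜ := by
    ext y
    simp only [mem_ofPred_eq, mem_iInter]
    refine forall₂_congr fun A _ => ?_
    split_ifs with h <;> simp [h]
  rw [this]
  refine h𝓕.biInter_mem S fun A hA => ?_
  split_ifs
  · exact hS hA
  · exact h𝓕.compl_mem (hS hA)

theorem isHomOn_preimage (𝒮 : Set (Set X)) (Φ : Y → X) : IsHomOn 𝒮 (Φ ⁻¹' ·) :=
  ⟨fun _ _ _ _ => rfl, fun _ _ _ _ => rfl, rfl, rfl⟩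

/-- A homomorphism from the algebra of a finite partition to a power set is given by a point
map. -/
theorem IsHomOn.exists_eq_preimage {P : Finpartition (univ : Set X)} {φ : Set X → Set Y}
    (hφ : IsHomOn (sigmaSets P) φ) : ∃ Φ : Y → X, ∀ A ∈ sigmaSets P, φ A = Φ ⁻¹' A := by
  classical
  have hunion : ∀ S : Finset (Set X), S ⊆ P.parts →
      φ (⋃ C ∈ S, C) = ⋃ C ∈ S, φ C ∧ (⋃ C ∈ S, C) ∈ sigmaSets P := by
    intro S
    induction S using Finset.induction_on with
    | empty =>
      intro _
      refine ⟨by simp [hφ.map_empty], ?_⟩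
      simpa using compl_mem_sigmaSets (univ_mem_sigmaSets P)
    | insert C S _ ih =>
      intro h
      obtain ⟨h₁, h₂⟩ := ih ((Finset.subset_insert _ _).trans h)
      have hC := mem_sigmaSets_of_mem_parts (h (Finset.mem_insert_self _ _))
      simp only [Finset.mem_insert, iUnion_iUnion_eq_or_left]
      refine ⟨by rw [hφ.map_union _ hC _ h₂, h₁], ?_⟩
      exact union_mem_sigmaSets hC h₂
  -- The images of the cells cover Y because φ preserves the whole space. Φ sends y to any point of
  -- a cell whose image contains y.
  have hcover : ∀ y, ∃ x, ∃ C ∈ P.parts, x ∈ C ∧ y ∈ φ C := by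
    intro y
    have huniv : (⋃ C ∈ P.parts, C) = univ := by
      refine eq_univ_of_forall fun x => ?_
      obtain ⟨C, hC, hx⟩ := exists_mem_parts P x
      exact mem_biUnion (s := (P.parts : Set (Set X))) hC hx
    have hy : y ∈ φ (⋃ C ∈ P.parts, C) := by rw [huniv, hφ.map_univ]; trivial
    rw [(hunion _ subset_rfl).1] at hy
    simp only [mem_iUnion] at hy
    obtain ⟨C, hC, hy⟩ := hy
    obtain ⟨x, hx⟩ := Set.nonempty_iff_ne_empty.2 (P.ne_bot hC)
    exact ⟨x, C, hC, hx, hy⟩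
  choose Φ C hC hΦ hy using hcover
  have key : ∀ A ∈ sigmaSets P, ∀ y, Φ y ∈ A → y ∈ φ A := by
    intro A hA y h
    have hsub : C y ∩ A = C y :=
      inter_eq_left.2 fun z hz => mem_sigmaSets_iff.1 hA _ (hC y) _ (hΦ y) z hz h
    have := hφ.map_inter _ (mem_sigmaSets_of_mem_parts (hC y)) A hA
    rw [hsub] at this
    exact (this ▸ hy y : y ∈ φ (C y) ∩ φ A).2
  refine ⟨Φ, fun A hA => Set.ext fun y => ⟨fun h => ?_, key A hA y⟩⟩
  by_contra h'
  -- The images of A and of its complement are disjoint, so the inclusion just proved, used for the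
  -- complement, gives the reverse one.
  have h₂ := key Aᶜ (compl_mem_sigmaSets hA) y h'
  have := hφ.map_inter _ hA _ (compl_mem_sigmaSets hA)
  rw [inter_compl_self, hφ.map_empty] at this
  exact this.symm.subset ⟨h, h₂⟩

end Partitions

/-! ### Sets of arrows acting on sets of objects -/

section SetAct

variable {K : Type*} [ArrowGroupoid K]

theorem mem_setAct {f : Set K} {A : Set (UnitSpace K)} {y : UnitSpace K} :
    y ∈ setAct f A ↔ ∃ h ∈ f, src h ∈ A ∧ rng h = y := by
  simp [setAct, and_assoc]

/-- Injectivity of the range map makes the arrow ending at a given object unique, so the action on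
sets can be tested at one arrow and respects Boolean operations. -/
theorem rng_mem_setAct_iff {f : Set K} (hf : InjOn rng f) {A : Set (UnitSpace K)} {h : K}
    (hh : h ∈ f) : rng h ∈ setAct f A ↔ src h ∈ A := by
  rw [mem_setAct]
  constructor
  · rintro ⟨k, hk, hA, hkh⟩
    rwa [← hf hk hh hkh]
  · exact fun hA => ⟨h, hh, hA, rfl⟩

theorem setAct_mono (f : Set K) {A B : Set (UnitSpace K)} (h : A ⊆ B) :
    setAct f A ⊆ setAct f B :=
  image_mono (inter_subset_inter_right _ (preimage_mono h))

theorem setAct_symmDiff {f : Set K} (hf : InjOn rng f) (A B : Set (UnitSpace K)) :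
    setAct f A ∆ setAct f B = setAct f (A ∆ B) := by
  ext y
  by_cases hy : ∃ h ∈ f, rng h = y
  · obtain ⟨h, hh, rfl⟩ := hy
    simp only [mem_symmDiff, rng_mem_setAct_iff hf hh]
  · have : ∀ C, y ∉ setAct f C := by
      intro C hC
      obtain ⟨h, hh, -, rfl⟩ := mem_setAct.1 hC
      exact hy ⟨h, hh, rfl⟩
    simp [mem_symmDiff, this]

theorem setAct_setComp (f g : Set K) (A : Set (UnitSpace K)) :
    setAct (setComp f g) A = setAct f (setAct g A) := by
  ext y
  simp only [mem_setAct]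
  constructor
  · rintro ⟨_, ⟨a, ha, b, hb, hab, rfl⟩, hA, rfl⟩
    exact ⟨a, ha, ⟨b, hb, by rwa [src, ArrowGroupoid.src_comp] at hA, hab.symm⟩,
      (ArrowGroupoid.rng_comp a b hab).symm⟩
  · rintro ⟨a, ha, ⟨b, hb, hA, hab⟩, rfl⟩
    exact ⟨_, ⟨a, ha, b, hb, hab.symm, rfl⟩, by rwa [src, ArrowGroupoid.src_comp],
      ArrowGroupoid.rng_comp a b hab.symm⟩

theorem setAct_symmDiff_subset (f g : Set K) (A : Set (UnitSpace K)) :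
    setAct f A ∆ setAct g A ⊆ rng '' (f ∆ g) := by
  rintro y (⟨h₁, h₂⟩ | ⟨h₁, h₂⟩)
  · obtain ⟨h, hh, hA, rfl⟩ := mem_setAct.1 h₁
    exact ⟨h, Or.inl ⟨hh, fun hg => h₂ (mem_setAct.2 ⟨h, hg, hA, rfl⟩)⟩, rfl⟩
  · obtain ⟨h, hh, hA, rfl⟩ := mem_setAct.1 h₁
    exact ⟨h, Or.inr ⟨hh, fun hg => h₂ (mem_setAct.2 ⟨h, hg, hA, rfl⟩)⟩, rfl⟩

end SetAct

theorem PartialAut.injOn_src {K : Type*} [MeasurableSpace K] [MeasurableGroupoid K]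
    (f : PartialAut K) : InjOn src f.carrier :=
  (isPartialAut_iff.1 f.isPartialAut).2.1

theorem PartialAut.injOn_rng {K : Type*} [MeasurableSpace K] [MeasurableGroupoid K]
    (f : PartialAut K) : InjOn rng f.carrier :=
  (isPartialAut_iff.1 f.isPartialAut).2.2

/-! ### Normalized counting -/

section NormCard

variable {X : Type*} {d : ℕ}

theorem normCard_le_of_ncard_le {Y : Type*} {A : Set X} {B : Set Y} (h : A.ncard ≤ B.ncard) :
    normCard d A ≤ normCard d B := by
  unfold normCard; gcongr

theorem normCard_mono [Finite X] {A B : Set X} (h : A ⊆ B) : normCard d A ≤ normCard d B :=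
  normCard_le_of_ncard_le (ncard_le_ncard h)

theorem normCard_le_add [Finite X] {A B C : Set X} (h : A ⊆ B ∪ C) :
    normCard d A ≤ normCard d B + normCard d C := by
  have : A.ncard ≤ B.ncard + C.ncard := (ncard_le_ncard h).trans (ncard_union_le B C)
  unfold normCard
  rw [← add_div]
  gcongr
  exact_mod_cast this

theorem normCard_symmDiff_le [Finite X] (A B C : Set X) :
    normCard d (A ∆ C) ≤ normCard d (A ∆ B) + normCard d (B ∆ C) :=
  normCard_le_add (symmDiff_triangle A B C)

theorem normCard_le_sum [Finite X] {ι : Type*} {A : Set X} (s : Finset ι) (B : ι → Set X)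
    (h : A ⊆ ⋃ i ∈ s, B i) : normCard d A ≤ ∑ i ∈ s, normCard d (B i) := by
  have : A.ncard ≤ ∑ i ∈ s, (B i).ncard := (ncard_le_ncard h).trans (s.set_ncard_biUnion_le B)
  unfold normCard
  rw [← Finset.sum_div]
  gcongr
  exact_mod_cast this

theorem normCard_biUnion [Finite X] {ι : Type*} (s : Finset ι) (B : ι → Set X)
    (h : (s : Set ι).PairwiseDisjoint B) :
    normCard d (⋃ i ∈ s, B i) = ∑ i ∈ s, normCard d (B i) := by
  have := s.finite_toSet.ncard_biUnion (fun i _ => (B i).toFinite) h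
  rw [finsum_mem_coe_finset] at this
  unfold normCard
  rw [← Finset.sum_div]
  congr 1
  exact_mod_cast this

theorem normCard_setAct_le (f : PartialAut (FullGroupoid d))
    (A : Set (UnitSpace (FullGroupoid d))) : normCard d (setAct f.carrier A) ≤ normCard d A := by
  refine normCard_le_of_ncard_le ((ncard_image_le (toFinite _)).trans ?_)
  exact ncard_le_ncard_of_injOn src (fun h hh => hh.2) (f.injOn_src.mono inter_subset_left)

theorem normCard_setAct_symmDiff_le (f : PartialAut (FullGroupoid d))
    (A B : Set (UnitSpace (FullGroupoid d))) :
    normCard d (setAct f.carrier A ∆ setAct f.carrier B) ≤ normCard d (A ∆ B) := by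
  rw [setAct_symmDiff f.injOn_rng]
  exact normCard_setAct_le f _

/-- Turns approximate multiplicativity, stated for sets of arrows, into approximate multiplicativity
of the action, uniformly in the set acted on. -/
theorem normCard_setAct_symmDiff_le_carrier (f g : PartialAut (FullGroupoid d))
    (A : Set (UnitSpace (FullGroupoid d))) :
    normCard d (setAct f.carrier A ∆ setAct g.carrier A) ≤
      normCard d (f.carrier ∆ g.carrier) :=
  (normCard_mono (setAct_symmDiff_subset _ _ _)).trans
    (normCard_le_of_ncard_le (ncard_image_le (toFinite _)))

end NormCard

/-! ### The action of partial automorphisms on the unit space of an extension -/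

section Extension

variable {G H : Type*} [MeasurableSpace G] [DiscreteMeasurableGroupoid G] [MeasurableSpace H]
  [DiscreteMeasurableGroupoid H] {μ : Measure (UnitSpace G)} {ν : Measure (UnitSpace H)}
  {π : G → H}

namespace IsPMPClassBijectiveExtension

theorem src_map (hπ : IsPMPClassBijectiveExtension π μ ν) (g : G) :
    src (π g) = ⟨π (src g), hπ.map_unit _⟩ :=
  (hπ.bijOn_src (src g)).mapsTo rfl

theorem rng_map (hπ : IsPMPClassBijectiveExtension π μ ν) (g : G) :
    rng (π g) = ⟨π (rng g), hπ.map_unit _⟩ :=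
  (hπ.bijOn_rng (rng g)).mapsTo rfl

/-- Arrows of π⁻¹(f) with a common range have images in f with a common range, hence equal images; π
is injective on the range fibre. -/
theorem injOn_rng (hπ : IsPMPClassBijectiveExtension π μ ν) (f : PartialAut H) :
    InjOn rng (π ⁻¹' f.carrier) := by
  intro g hg k hk h
  refine (hπ.bijOn_rng (rng k)).injOn h rfl (f.injOn_rng hg hk ?_)
  rw [hπ.rng_map, hπ.rng_map, Subtype.mk.injEq]
  exact congrArg (fun x : UnitSpace G => π x) h

theorem injOn_src (hπ : IsPMPClassBijectiveExtension π μ ν) (f : PartialAut H) :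
    InjOn src (π ⁻¹' f.carrier) := by
  intro g hg k hk h
  refine (hπ.bijOn_src (src k)).injOn h rfl (f.injOn_src hg hk ?_)
  rw [hπ.src_map, hπ.src_map, Subtype.mk.injEq]
  exact congrArg (fun x : UnitSpace G => π x) h

theorem preimage_units (hπ : IsPMPClassBijectiveExtension π μ ν) :
    π ⁻¹' (ArrowGroupoid.units : Set H) = (ArrowGroupoid.units : Set G) := by
  refine Subset.antisymm (fun g hg => ?_) fun g hg => hπ.map_unit ⟨g, hg⟩
  have h₁ : src (π g) = ⟨π g, hg⟩ := ArrowGroupoid.src_unit ⟨π g, hg⟩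
  rw [hπ.src_map, Subtype.mk.injEq] at h₁
  -- The arrow g and the unit at its source lie in one source fibre and have the same image, so they
  -- coincide.
  have := (hπ.bijOn_src (src g)).injOn (ArrowGroupoid.src_unit (src g)) rfl h₁
  rw [← this]
  exact (src g).2

theorem act_one (hπ : IsPMPClassBijectiveExtension π μ ν) (A : Set (UnitSpace G)) :
    act π 1 A = A := by
  have h : π ⁻¹' (1 : PartialAut H).carrier = (ArrowGroupoid.units : Set G) := hπ.preimage_units
  ext x
  rw [act, h, mem_setAct]
  constructor
  · rintro ⟨g, hg, hA, rfl⟩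
    have h₁ : src g = ⟨g, hg⟩ := ArrowGroupoid.src_unit ⟨g, hg⟩
    have h₂ : rng g = ⟨g, hg⟩ := ArrowGroupoid.rng_unit ⟨g, hg⟩
    rwa [h₂, ← h₁]
  · intro hx
    refine ⟨x, x.2, ?_, ArrowGroupoid.rng_unit x⟩
    rwa [src, ArrowGroupoid.src_unit x]

theorem preimage_setComp (hπ : IsPMPClassBijectiveExtension π μ ν) (s t : Set H) :
    π ⁻¹' setComp s t = setComp (π ⁻¹' s) (π ⁻¹' t) := by
  ext g
  constructor
  · rintro ⟨a, ha, b, hb, hab, hg⟩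
    -- Lift the right factor to start at the source of g, then the left factor to start where that
    -- lift ends; uniqueness of lifts identifies the product with g.
    obtain ⟨b', hb', rfl⟩ := (hπ.bijOn_src (src g)).surjOn
      (show b ∈ src ⁻¹' {⟨π (src g), hπ.map_unit _⟩} by
        rw [mem_preimage, mem_singleton_iff, ← hπ.src_map, ← hg, src, src,
          ArrowGroupoid.src_comp])
    obtain ⟨a', ha', rfl⟩ := (hπ.bijOn_src (rng b')).surjOn
      (show a ∈ src ⁻¹' {⟨π (rng b'), hπ.map_unit _⟩} by
        rw [mem_preimage, mem_singleton_iff, ← hπ.rng_map]; exact hab)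
    have hab' : src a' = rng b' := ha'
    refine ⟨a', ha, b', hb, hab', ?_⟩
    obtain ⟨h', h⟩ := hπ.map_comp a' b' hab'
    exact (hπ.bijOn_src (src g)).injOn ((ArrowGroupoid.src_comp a' b' hab').trans hb') rfl
      (h.trans hg)
  · rintro ⟨a, ha, b, hb, hab, rfl⟩
    obtain ⟨h', h⟩ := hπ.map_comp a b hab
    exact ⟨π a, ha, π b, hb, h', h.symm⟩

theorem act_mul (hπ : IsPMPClassBijectiveExtension π μ ν) (f g : PartialAut H)
    (A : Set (UnitSpace G)) : act π (f * g) A = act π f (act π g A) := by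
  rw [act, act, act, ← setAct_setComp, ← hπ.preimage_setComp]
  rfl

theorem measurableSet_arrows (hπ : IsPMPClassBijectiveExtension π μ ν) (f : PartialAut H)
    {A : Set (UnitSpace G)} (hA : MeasurableSet A) :
    MeasurableSet (π ⁻¹' f.carrier ∩ src ⁻¹' A) :=
  (hπ.measurable f.isPartialAut.measurableSet).inter (MeasurableGroupoid.measurable_src hA)

theorem measurableSet_act (hπ : IsPMPClassBijectiveExtension π μ ν) (f : PartialAut H)
    {A : Set (UnitSpace G)} (hA : MeasurableSet A) : MeasurableSet (act π f A) := by
  have : StandardBorelSpace (UnitSpace G) :=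
    (MeasurableGroupoid.measurableSet_units (H := G)).standardBorel
  exact (hπ.measurableSet_arrows f hA).image_of_measurable_injOn
    MeasurableGroupoid.measurable_rng ((hπ.injOn_rng f).mono inter_subset_left)

/-- Count the arrows of π⁻¹(f) starting in A in two ways: each point of f·A receives at least one,
each point of A emits at most one, and the pmp condition equates the two masses. -/
theorem measure_act_le (hπ : IsPMPClassBijectiveExtension π μ ν) (f : PartialAut H)
    {A : Set (UnitSpace G)} (hA : MeasurableSet A) : μ (act π f A) ≤ μ A := by
  set W : Set G := π ⁻¹' f.carrier ∩ src ⁻¹' A with hW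
  have h₁ : μ (act π f A) ≤ rngMass μ W := by
    rw [← lintegral_indicator_one (hπ.measurableSet_act f hA)]
    refine lintegral_mono fun x => ?_
    by_cases hx : x ∈ act π f A
    · obtain ⟨g, hg, rfl⟩ := hx
      rw [indicator_of_mem (show rng g ∈ act π f A from ⟨g, hg, rfl⟩)]
      have : (1 : ℕ∞) ≤ (ArrowGroupoid.rng ⁻¹' {rng g} ∩ W).encard :=
        one_le_encard_iff_nonempty.2 ⟨g, rfl, hg⟩
      simpa using ENat.toENNReal_le.2 this
    · rw [indicator_of_notMem hx]
      exact zero_le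
  have h₂ : srcMass μ W ≤ μ A := by
    rw [← lintegral_indicator_one hA]
    refine lintegral_mono fun x => ?_
    by_cases hx : x ∈ A
    · rw [indicator_of_mem hx]
      have : (ArrowGroupoid.src ⁻¹' {x} ∩ W).encard ≤ 1 :=
        encard_le_one_iff.2 fun a b ha hb =>
          hπ.injOn_src f ha.2.1 hb.2.1 (ha.1.trans hb.1.symm)
      simpa using ENat.toENNReal_le.2 this
    · have : ArrowGroupoid.src ⁻¹' {x} ∩ W = ∅ := by
        refine eq_empty_of_forall_notMem fun g hg => hx ?_
        have := hg.2.2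
        rwa [mem_preimage, show src g = x from hg.1] at this
      simp [this]
  rw [← hπ.isPMP_left.srcMass_eq_rngMass W (hπ.measurableSet_arrows f hA)] at h₁
  exact h₁.trans h₂

theorem measureReal_act_symmDiff_le (hπ : IsPMPClassBijectiveExtension π μ ν) (f : PartialAut H)
    {A B : Set (UnitSpace G)} (hA : MeasurableSet A) (hB : MeasurableSet B) :
    μ.real (act π f A ∆ act π f B) ≤ μ.real (A ∆ B) := by
  have := hπ.isPMP_left.isProbabilityMeasure
  rw [act, act, setAct_symmDiff (hπ.injOn_rng f)]
  exact ENNReal.toReal_mono (measure_ne_top _ _) (hπ.measure_act_le f (hA.symmDiff hB))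

end IsPMPClassBijectiveExtension

end Extension

/-! ### Translated partitions -/

section Translated

variable {G H : Type*} [ArrowGroupoid G] [MeasurableSpace H] [MeasurableGroupoid H] {π : G → H}
  {P Q : Finpartition (univ : Set (UnitSpace G))} {F F' : Finset (PartialAut H)}

/-- The points `x` and `y` belong to the same translates of cells of `P` by elements of `F`, that
is to the same cell of `P^F`. -/
def SameTranslates (π : G → H) (P : Finpartition (univ : Set (UnitSpace G)))
    (F : Finset (PartialAut H)) (x y : UnitSpace G) : Prop :=
  ∀ f ∈ F, ∀ A ∈ P.parts, x ∈ act π f A ↔ y ∈ act π f A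

theorem SameTranslates.symm {x y : UnitSpace G} (h : SameTranslates π P F x y) :
    SameTranslates π P F y x :=
  fun f hf A hA => (h f hf A hA).symm

theorem mem_sigmaSets_translatedPartition {A : Set (UnitSpace G)} :
    A ∈ sigmaSets (translatedPartition π P F) ↔
      ∀ x y, SameTranslates π P F x y → x ∈ A → y ∈ A := by
  classical
  rw [translatedPartition, mem_sigmaSets_generatedPartition]
  refine forall₂_congr fun x y => imp_congr_left ?_
  constructor
  · intro h f hf A hA
    exact h _ (Finset.mem_image.2 ⟨(f, A), Finset.mem_product.2 ⟨hf, hA⟩, rfl⟩)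
  · intro h B hB
    obtain ⟨⟨f, A⟩, hfA, rfl⟩ := Finset.mem_image.1 hB
    exact h f (Finset.mem_product.1 hfA).1 A (Finset.mem_product.1 hfA).2

/-- Acting commutes with unions, so it is enough to follow the one cell of P containing the source
of the arrow. -/
theorem act_mem_sigmaSets {f : PartialAut H} (hf : f ∈ F) {A : Set (UnitSpace G)}
    (hA : A ∈ sigmaSets P) : act π f A ∈ sigmaSets (translatedPartition π P F) := by
  rw [mem_sigmaSets_translatedPartition]
  intro x y hxy hx
  obtain ⟨g, hg, hgA, rfl⟩ := mem_setAct.1 hx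
  obtain ⟨C, hC, hgC⟩ := exists_mem_parts P (src g)
  have hy := (hxy f hf C hC).1 (mem_setAct.2 ⟨g, hg, hgC, rfl⟩)
  exact setAct_mono _ (fun z hz => mem_sigmaSets_iff.1 hA C hC _ hgC z hz hgA) hy

theorem translatedPartition_mono (hPQ : P ≤ Q) (hF : F ⊆ F') {A : Set (UnitSpace G)}
    (hA : A ∈ sigmaSets (translatedPartition π Q F)) :
    A ∈ sigmaSets (translatedPartition π P F') := by
  rw [mem_sigmaSets_translatedPartition] at hA
  refine mem_sigmaSets_translatedPartition.2 (fun x y hxy => hA x y fun f hf B hB => ?_)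
  have := act_mem_sigmaSets (π := π) (hF hf)
    (mem_sigmaSets_of_le hPQ (mem_sigmaSets_of_mem_parts hB))
  rw [mem_sigmaSets_translatedPartition] at this
  exact ⟨this x y hxy, this y x hxy.symm⟩

end Translated

/-! ### Good homomorphisms given by point maps -/

/-- Both quantities are additive over the cells inside E, so the total error over all cells controls
every member of the algebra. -/
theorem abs_normCard_sub_measureReal_le {X Y : Type*} [MeasurableSpace X] [Finite Y] {d : ℕ}
    (μ : Measure X) [IsFiniteMeasure μ] {R : Finpartition (univ : Set X)}
    (hR : ∀ C ∈ R.parts, MeasurableSet C) (Φ : Y → X) {E : Set X} (hE : E ∈ sigmaSets R) :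
    |normCard d (Φ ⁻¹' E) - μ.real E| ≤
      ∑ C ∈ R.parts, |normCard d (Φ ⁻¹' C) - μ.real C| := by
  classical
  set S := R.parts.filter (· ⊆ E) with hS
  have hES : E = ⋃ C ∈ S, C := by
    ext x
    simp only [mem_iUnion, hS, Finset.mem_filter, exists_prop]
    constructor
    · intro hx
      obtain ⟨C, hC, hxC⟩ := exists_mem_parts R x
      exact ⟨C, ⟨hC, fun y hy => mem_sigmaSets_iff.1 hE C hC x hxC y hy hx⟩, hxC⟩
    · rintro ⟨C, ⟨-, hCE⟩, hx⟩
      exact hCE hx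
  have hdisj : (S : Set (Set X)).PairwiseDisjoint id := fun C hC D hD h =>
    R.disjoint (Finset.filter_subset _ _ hC) (Finset.filter_subset _ _ hD) h
  have h₁ : normCard d (Φ ⁻¹' E) = ∑ C ∈ S, normCard d (Φ ⁻¹' C) := by
    conv_lhs => rw [hES, preimage_iUnion₂]
    exact normCard_biUnion S (fun C => Φ ⁻¹' C) fun C hC D hD h => (hdisj hC hD h).preimage Φ
  have h₂ : μ.real E = ∑ C ∈ S, μ.real C := by
    conv_lhs => rw [hES]
    exact measureReal_biUnion_finset hdisj fun C hC => hR C (Finset.filter_subset _ _ hC)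
  rw [h₁, h₂, ← Finset.sum_sub_distrib]
  exact (Finset.abs_sum_le_sum_abs _ _).trans
    (Finset.sum_le_sum_of_subset_of_nonneg (Finset.filter_subset _ _) fun _ _ _ => abs_nonneg _)

theorem isSetAlgebra_borelSets (X : Type*) [MeasurableSpace X] : IsSetAlgebra (borelSets X) where
  empty_mem := MeasurableSet.empty
  compl_mem := fun _ h => MeasurableSet.compl (show MeasurableSet _ from h)
  union_mem := fun _ _ h h' =>
    MeasurableSet.union (show MeasurableSet _ from h) (show MeasurableSet _ from h')

section GoodHom

variable {G H : Type*} [MeasurableSpace G] [DiscreteMeasurableGroupoid G] [MeasurableSpace H]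
  [DiscreteMeasurableGroupoid H] {μ : Measure (UnitSpace G)} {ν : Measure (UnitSpace H)}
  {π : G → H} {d : ℕ} {σ : SoficMap H d} {P : Finpartition (univ : Set (UnitSpace G))}
  {F K : Finset (PartialAut H)} {δ : ℝ} {Φ : UnitSpace (FullGroupoid d) → UnitSpace G}

theorem IsPMPClassBijectiveExtension.sigmaSets_subset (hπ : IsPMPClassBijectiveExtension π μ ν)
    (h1 : 1 ∈ F) {A : Set (UnitSpace G)} (hA : A ∈ sigmaSets P) :
    A ∈ sigmaSets (translatedPartition π P F) := by
  have := act_mem_sigmaSets (π := π) h1 hA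
  rwa [hπ.act_one] at this

theorem IsPMPClassBijectiveExtension.measurableSet_parts_translatedPartition
    (hπ : IsPMPClassBijectiveExtension π μ ν) (hP : ∀ C ∈ P.parts, MeasurableSet C)
    {C : Set (UnitSpace G)} (hC : C ∈ (translatedPartition π P F).parts) : MeasurableSet C := by
  classical
  refine parts_generatedPartition_subset (𝓕 := borelSets (UnitSpace G))
    (isSetAlgebra_borelSets _) ?_ hC
  intro A hA
  obtain ⟨⟨f, B⟩, hfB, rfl⟩ := Finset.mem_image.1 hA
  exact hπ.measurableSet_act f (hP B (Finset.mem_product.1 hfB).2)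

theorem measurableSet_of_mem_sigmaSets {X : Type*} [MeasurableSpace X]
    {R : Finpartition (univ : Set X)} (hR : ∀ C ∈ R.parts, MeasurableSet C) {A : Set X}
    (hA : A ∈ sigmaSets R) : MeasurableSet A :=
  MeasurableSpace.generateFrom_le hR A hA

theorem IsPMPClassBijectiveExtension.rng_mem_act_iff (hπ : IsPMPClassBijectiveExtension π μ ν)
    {f : PartialAut H} {g : G} (hg : g ∈ π ⁻¹' f.carrier) {A : Set (UnitSpace G)} :
    rng g ∈ act π f A ↔ src g ∈ A :=
  rng_mem_setAct_iff (hπ.injOn_rng f) hg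

/-- A good homomorphism is given by a point map. -/
theorem IsGoodHom.exists_pointMap {φ : Set (UnitSpace G) → Set (UnitSpace (FullGroupoid d))}
    (hφ : IsGoodHom π μ σ P F δ φ) (hπ : IsPMPClassBijectiveExtension π μ ν) (h1 : 1 ∈ F) :
    ∃ Φ : UnitSpace (FullGroupoid d) → UnitSpace G,
      (∀ A ∈ sigmaSets (translatedPartition π P F), φ A = Φ ⁻¹' A) ∧
        IsGoodHom π μ σ P F δ (Φ ⁻¹' ·) := by
  obtain ⟨Φ, hΦ⟩ := hφ.isHomOn.exists_eq_preimage
  refine ⟨Φ, hΦ, isHomOn_preimage _ Φ, fun f hf => ?_, ?_⟩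
  · refine lt_of_eq_of_lt (Finset.sum_congr rfl fun A hA => ?_) (hφ.equivariant f hf)
    have hA' := mem_sigmaSets_of_mem_parts hA
    rw [hΦ _ (act_mem_sigmaSets hf hA'), hΦ _ (hπ.sigmaSets_subset h1 hA')]
  · refine lt_of_eq_of_lt (Finset.sum_congr rfl fun A hA => ?_) hφ.measure
    rw [hΦ _ (mem_sigmaSets_of_mem_parts hA)]

theorem IsGoodHom.normCard_lt (h : IsGoodHom π μ σ P F δ (Φ ⁻¹' ·))
    (hπ : IsPMPClassBijectiveExtension π μ ν) (hP : ∀ C ∈ P.parts, MeasurableSet C)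
    {E : Set (UnitSpace G)} (hE : E ∈ sigmaSets (translatedPartition π P F)) :
    |normCard d (Φ ⁻¹' E) - μ.real E| < δ := by
  have := hπ.isPMP_left.isProbabilityMeasure
  exact (abs_normCard_sub_measureReal_le μ
    (fun C hC => hπ.measurableSet_parts_translatedPartition hP hC) Φ hE).trans_lt h.measure

/-- The equivariance defect of a union of cells is contained in the union of the defects of those
cells, whose total is below δ. -/
theorem IsGoodHom.equivariant_sigmaSets (h : IsGoodHom π μ σ P F δ (Φ ⁻¹' ·))
    {f : PartialAut H} (hf : f ∈ F) {A : Set (UnitSpace G)} (hA : A ∈ sigmaSets P) :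
    normCard d (setAct (σ f).carrier (Φ ⁻¹' A) ∆ (Φ ⁻¹' act π f A)) < δ := by
  refine lt_of_le_of_lt (normCard_le_sum P.parts
    (fun C => setAct (σ f).carrier (Φ ⁻¹' C) ∆ (Φ ⁻¹' act π f C)) ?_) (h.equivariant f hf)
  have hsub : ∀ x ∈ A, ∃ C ∈ P.parts, x ∈ C ∧ C ⊆ A := by
    intro x hx
    obtain ⟨C, hC, hxC⟩ := exists_mem_parts P x
    exact ⟨C, hC, hxC, fun y hy => mem_sigmaSets_iff.1 hA C hC x hxC y hy hx⟩
  rintro y (⟨h₁, h₂⟩ | ⟨h₁, h₂⟩)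
  · obtain ⟨g, hg, hgA, rfl⟩ := mem_setAct.1 h₁
    obtain ⟨C, hC, hgC, hCA⟩ := hsub _ hgA
    exact mem_biUnion (s := (P.parts : Set (Set (UnitSpace G)))) hC
      (Or.inl ⟨mem_setAct.2 ⟨g, hg, hgC, rfl⟩, fun h' => h₂ (setAct_mono _ hCA h')⟩)
  · obtain ⟨g, hg, hgA, hgy⟩ := mem_setAct.1 h₁
    obtain ⟨C, hC, hgC, hCA⟩ := hsub _ hgA
    exact mem_biUnion (s := (P.parts : Set (Set (UnitSpace G)))) hC
      (Or.inr ⟨mem_setAct.2 ⟨g, hg, hgC, hgy⟩,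
        fun h' => h₂ (setAct_mono _ (preimage_mono hCA) h')⟩)

/-- Good homomorphisms for `P` are almost equivariant on the algebra of a partition `P^K`. -/
theorem IsGoodHom.equivariant_translated (h : IsGoodHom π μ σ P F δ (Φ ⁻¹' ·))
    (hπ : IsPMPClassBijectiveExtension π μ ν) (hσ : IsMultiplicative F δ σ)
    {f : PartialAut H} (hf : f ∈ F) (hK : K ⊆ F) (hfK : ∀ k ∈ K, f * k ∈ F)
    {E : Set (UnitSpace G)} (hE : E ∈ sigmaSets (translatedPartition π P K)) :
    normCard d (setAct (σ f).carrier (Φ ⁻¹' E) ∆ (Φ ⁻¹' act π f E)) ≤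
      (3 * (K.card * P.parts.card) + 1) * δ := by
  set B : PartialAut H × Set (UnitSpace G) → Set (UnitSpace (FullGroupoid d)) := fun q =>
    setAct (σ f).carrier (Φ ⁻¹' act π q.1 q.2) ∆ (Φ ⁻¹' act π f (act π q.1 q.2)) with hB
  -- The whole-space defect is listed separately: outside it, an arrow of σ(f) ends at y exactly
  -- when an arrow of π⁻¹(f) ends at Φ y. It accounts for the +1 in the bound.
  set B₀ := setAct (σ f).carrier (Φ ⁻¹' univ) ∆ (Φ ⁻¹' act π f univ) with hB₀
  have hsub : setAct (σ f).carrier (Φ ⁻¹' E) ∆ (Φ ⁻¹' act π f E) ⊆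
      (⋃ q ∈ K ×ˢ P.parts, B q) ∪ B₀ := by
    intro y hy
    by_contra hyB
    rw [mem_union, not_or] at hyB
    obtain ⟨hyB, hyB₀⟩ := hyB
    have hyB₀ : y ∈ setAct (σ f).carrier (Φ ⁻¹' univ) ↔ Φ y ∈ act π f univ := by
      rw [hB₀, mem_symmDiff] at hyB₀
      simp only [mem_preimage (f := Φ) (a := y)] at hyB₀
      tauto
    have hyB : ∀ k ∈ K, ∀ A ∈ P.parts, y ∈ setAct (σ f).carrier (Φ ⁻¹' act π k A) ↔
        Φ y ∈ act π f (act π k A) := by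
      intro k hk A hA
      have : y ∉ B (k, A) := fun h' => hyB (mem_biUnion
        (s := ((K ×ˢ P.parts : Finset _) : Set (PartialAut H × Set (UnitSpace G))))
        (Finset.mem_product.2 ⟨hk, hA⟩) h')
      simp only [hB, mem_symmDiff, mem_preimage (f := Φ) (a := y)] at this
      tauto
    have key : ∀ e ∈ (σ f).carrier, rng e = y → ∀ g ∈ π ⁻¹' f.carrier, rng g = Φ y →
        (y ∈ setAct (σ f).carrier (Φ ⁻¹' E) ↔ Φ y ∈ act π f E) := by
      rintro e he rfl g hg hgy
      -- Outside the exceptional sets, Φ applied to the source of the model arrow lies in the same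
      -- cell of P^K as the source of the true arrow, so no set in Σ(P^K) separates them.
      have hsame : SameTranslates π P K (Φ (src e)) (src g) := by
        intro k hk A hA
        have := hyB k hk A hA
        rwa [rng_mem_setAct_iff (σ f).injOn_rng he, ← hgy, hπ.rng_mem_act_iff hg] at this
      rw [rng_mem_setAct_iff (σ f).injOn_rng he, ← hgy, hπ.rng_mem_act_iff hg]
      rw [mem_sigmaSets_translatedPartition] at hE
      exact ⟨hE _ _ hsame, hE _ _ hsame.symm⟩
    have hiff : y ∈ setAct (σ f).carrier (Φ ⁻¹' E) ↔ Φ y ∈ act π f E := by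
      constructor
      · intro h'
        obtain ⟨e, he, -, hey⟩ := mem_setAct.1 h'
        obtain ⟨g, hg, -, hgy⟩ := mem_setAct.1
          (hyB₀.1 (setAct_mono _ (preimage_mono (subset_univ E)) h'))
        exact (key e he hey g hg hgy).1 h'
      · intro h'
        obtain ⟨g, hg, -, hgy⟩ := mem_setAct.1 h'
        obtain ⟨e, he, -, hey⟩ := mem_setAct.1 (hyB₀.2 (setAct_mono _ (subset_univ E) h'))
        exact (key e he hey g hg hgy).2 h'
    rw [mem_symmDiff, mem_preimage] at hy
    tauto
  -- Three errors of size δ: equivariance for k, multiplicativity for the product f k, and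
  -- equivariance for f k.
  have hBq : ∀ q ∈ K ×ˢ P.parts, normCard d (B q) ≤ 3 * δ := by
    rintro ⟨k, A⟩ hq
    obtain ⟨hk, hA⟩ := Finset.mem_product.1 hq
    have hA' := mem_sigmaSets_of_mem_parts hA
    have h₁ : normCard d (setAct (σ f).carrier (Φ ⁻¹' act π k A) ∆
        setAct (σ f).carrier (setAct (σ k).carrier (Φ ⁻¹' A))) ≤ δ := by
      refine (normCard_setAct_symmDiff_le _ _ _).trans ?_
      rw [symmDiff_comm]
      exact (h.equivariant_sigmaSets (hK hk) hA').le
    have h₂ : normCard d (setAct (σ f).carrier (setAct (σ k).carrier (Φ ⁻¹' A)) ∆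
        setAct (σ (f * k)).carrier (Φ ⁻¹' A)) ≤ δ := by
      rw [← setAct_setComp, symmDiff_comm]
      exact (normCard_setAct_symmDiff_le_carrier (σ (f * k)) (σ f * σ k) _).trans
        (hσ f hf k (hK hk)).le
    have h₃ : normCard d (setAct (σ (f * k)).carrier (Φ ⁻¹' A) ∆
        (Φ ⁻¹' act π f (act π k A))) ≤ δ := by
      rw [← hπ.act_mul]
      exact (h.equivariant_sigmaSets (hfK k hk) hA').le
    have h₄ := normCard_symmDiff_le (d := d) (setAct (σ f).carrier (Φ ⁻¹' act π k A))
      (setAct (σ f).carrier (setAct (σ k).carrier (Φ ⁻¹' A))) (Φ ⁻¹' act π f (act π k A))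
    have h₅ := normCard_symmDiff_le (d := d)
      (setAct (σ f).carrier (setAct (σ k).carrier (Φ ⁻¹' A)))
      (setAct (σ (f * k)).carrier (Φ ⁻¹' A)) (Φ ⁻¹' act π f (act π k A))
    simp only [hB]
    linarith
  have hB₀le : normCard d B₀ ≤ δ := (h.equivariant_sigmaSets hf (univ_mem_sigmaSets P)).le
  have hsum : normCard d (⋃ q ∈ K ×ˢ P.parts, B q) ≤ (K.card * P.parts.card) * (3 * δ) := by
    refine (normCard_le_sum _ _ subset_rfl).trans ((Finset.sum_le_card_nsmul _ _ _ hBq).trans ?_)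
    rw [Finset.card_product, nsmul_eq_mul, Nat.cast_mul]
  have := normCard_le_add (d := d) hsub
  linarith

/-- Two good homomorphisms which agree on the algebra of `Q` almost agree on that of `Q^K`. -/
theorem IsGoodHom.normCard_symmDiff_le_of_eq {Φ' : UnitSpace (FullGroupoid d) → UnitSpace G}
    {Q : Finpartition (univ : Set (UnitSpace G))}
    (h : IsGoodHom π μ σ P F δ (Φ ⁻¹' ·)) (h' : IsGoodHom π μ σ P F δ (Φ' ⁻¹' ·))
    (hPQ : P ≤ Q) (hK : K ⊆ F) (heq : ∀ A ∈ sigmaSets Q, Φ ⁻¹' A = Φ' ⁻¹' A)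
    {E : Set (UnitSpace G)} (hE : E ∈ sigmaSets (translatedPartition π Q K)) :
    normCard d ((Φ ⁻¹' E) ∆ (Φ' ⁻¹' E)) ≤ 2 * (K.card * Q.parts.card) * δ := by
  have hsub : (Φ ⁻¹' E) ∆ (Φ' ⁻¹' E) ⊆ ⋃ q ∈ K ×ˢ Q.parts,
      (Φ ⁻¹' act π q.1 q.2) ∆ (Φ' ⁻¹' act π q.1 q.2) := by
    intro y hy
    by_contra hyB
    have hsame : SameTranslates π Q K (Φ y) (Φ' y) := by
      intro k hk A hA
      have : y ∉ (Φ ⁻¹' act π k A) ∆ (Φ' ⁻¹' act π k A) := fun h' => hyB (mem_biUnion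
        (s := ((K ×ˢ Q.parts : Finset _) : Set (PartialAut H × Set (UnitSpace G))))
        (show (k, A) ∈ _ from Finset.mem_product.2 ⟨hk, hA⟩) h')
      simp only [mem_symmDiff, mem_preimage] at this
      tauto
    rw [mem_sigmaSets_translatedPartition] at hE
    have h₁ := hE _ _ hsame
    have h₂ := hE _ _ hsame.symm
    simp only [mem_symmDiff, mem_preimage] at hy
    tauto
  have hq : ∀ q ∈ K ×ˢ Q.parts,
      normCard d ((Φ ⁻¹' act π q.1 q.2) ∆ (Φ' ⁻¹' act π q.1 q.2)) ≤ 2 * δ := by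
    rintro ⟨k, A⟩ hq
    obtain ⟨hk, hA⟩ := Finset.mem_product.1 hq
    have hA' := mem_sigmaSets_of_mem_parts hA
    have h₁ := h.equivariant_sigmaSets (hK hk) (mem_sigmaSets_of_le hPQ hA')
    have h₂ := h'.equivariant_sigmaSets (hK hk) (mem_sigmaSets_of_le hPQ hA')
    rw [symmDiff_comm] at h₁
    rw [← heq A hA'] at h₂
    have := normCard_symmDiff_le (d := d) (Φ ⁻¹' act π k A) (setAct (σ k).carrier (Φ ⁻¹' A))
      (Φ' ⁻¹' act π k A)
    simp only
    linarith
  refine (normCard_le_sum _ _ hsub).trans ((Finset.sum_le_card_nsmul _ _ _ hq).trans ?_)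
  rw [Finset.card_product, nsmul_eq_mul, Nat.cast_mul]
  linarith

end GoodHom

section Approximation

variable {G H : Type*} [MeasurableSpace G] [DiscreteMeasurableGroupoid G] [MeasurableSpace H]
  [DiscreteMeasurableGroupoid H] {μ : Measure (UnitSpace G)} {ν : Measure (UnitSpace H)}
  {π : G → H} {𝓕 : Set (Set (UnitSpace G))}

/-! ### Approximation by translates of a generating algebra -/

theorem exists_common_refinement {X : Type*} {𝓕 : Set (Set X)} (h𝓕 : IsSetAlgebra 𝓕)
    {P Q : Finpartition (univ : Set X)} (hP : (P.parts : Set (Set X)) ⊆ 𝓕)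
    (hQ : (Q.parts : Set (Set X)) ⊆ 𝓕) :
    ∃ R : Finpartition (univ : Set X), R ≤ P ∧ R ≤ Q ∧ (R.parts : Set (Set X)) ⊆ 𝓕 := by
  classical
  refine ⟨generatedPartition (P.parts ∪ Q.parts),
    generatedPartition_le Finset.subset_union_left,
    generatedPartition_le Finset.subset_union_right,
    parts_generatedPartition_subset h𝓕 ?_⟩
  rw [Finset.coe_union]
  exact union_subset hP hQ

/-- A member of the generated algebra involves finitely many translates; common refinements and
unions of the arrow sets put them all in a single P^K. -/
theorem exists_mem_sigmaSets_translatedPartition (h𝓕 : IsSetAlgebra 𝓕) {A : Set (UnitSpace G)}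
    (hA : A ∈ generateSetAlgebra {B | ∃ f : PartialAut H, ∃ P ∈ 𝓕, B = act π f P}) :
    ∃ (Q : Finpartition (univ : Set (UnitSpace G))) (K : Finset (PartialAut H)),
      (Q.parts : Set (Set (UnitSpace G))) ⊆ 𝓕 ∧ A ∈ sigmaSets (translatedPartition π Q K) := by
  classical
  induction hA with
  | base s hs =>
    obtain ⟨f, P, hP, rfl⟩ := hs
    refine ⟨generatedPartition {P}, {f},
      parts_generatedPartition_subset h𝓕 (by simpa using hP),
      act_mem_sigmaSets (Finset.mem_singleton_self f) ?_⟩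
    rw [mem_sigmaSets_generatedPartition]
    intro x y h
    exact (h P (Finset.mem_singleton_self P)).1
  | empty =>
    exact ⟨generatedPartition ∅, ∅, parts_generatedPartition_subset h𝓕 (by simp),
      by simpa using compl_mem_sigmaSets (univ_mem_sigmaSets _)⟩
  | compl s _ ih =>
    obtain ⟨Q, K, hQ, hs⟩ := ih
    exact ⟨Q, K, hQ, compl_mem_sigmaSets hs⟩
  | union s t _ _ ihs iht =>
    obtain ⟨Q, K, hQ, hs⟩ := ihs
    obtain ⟨Q', K', hQ', ht⟩ := iht
    obtain ⟨R, hRQ, hRQ', hR⟩ := exists_common_refinement h𝓕 hQ hQ'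
    refine ⟨R, K ∪ K', hR, ?_⟩
    exact union_mem_sigmaSets
      (translatedPartition_mono hRQ Finset.subset_union_left hs)
      (translatedPartition_mono hRQ' Finset.subset_union_right ht)

theorem IsGenerating.exists_approx (h𝓕 : IsGenerating π μ 𝓕)
    (hπ : IsPMPClassBijectiveExtension π μ ν) {B : Set (UnitSpace G)} (hB : MeasurableSet B)
    {ε : ℝ} (hε : 0 < ε) :
    ∃ (Q : Finpartition (univ : Set (UnitSpace G))) (K : Finset (PartialAut H)),
      (Q.parts : Set (Set (UnitSpace G))) ⊆ 𝓕 ∧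
        ∃ A ∈ sigmaSets (translatedPartition π Q K), μ.real (B ∆ A) < ε := by
  have := hπ.isPMP_left.isProbabilityMeasure
  obtain ⟨A, hA, hAB⟩ := h𝓕.generates B hB
  have hle : generatedSigmaAlgebra π 𝓕 ≤ (inferInstance : MeasurableSpace (UnitSpace G)) := by
    refine MeasurableSpace.generateFrom_le ?_
    rintro _ ⟨f, P, hP, rfl⟩
    exact hπ.measurableSet_act f (h𝓕.subset_borel hP)
  have hgen := generateFrom_generateSetAlgebra_eq
    (𝒜 := {B | ∃ f : PartialAut H, ∃ P ∈ 𝓕, B = act π f P})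
  -- The measure is trimmed to the σ-algebra generated by the translates, where their algebra is
  -- dense in measure.
  obtain ⟨t, ht, htA⟩ := exists_measure_symmDiff_lt_of_generateFrom_isSetRing
    (mα := generatedSigmaAlgebra π 𝓕) (μ := μ.trim hle)
    (C := generateSetAlgebra {B | ∃ f : PartialAut H, ∃ P ∈ 𝓕, B = act π f P})
    isSetAlgebra_generateSetAlgebra.isSetRing
    ⟨{univ}, countable_singleton _,
      singleton_subset_iff.2 isSetAlgebra_generateSetAlgebra.univ_mem, by simp⟩
    hgen.symm hA (ENNReal.ofReal_pos.2 hε)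
  have htm : MeasurableSet[generatedSigmaAlgebra π 𝓕] t := by
    rw [generatedSigmaAlgebra, ← hgen]
    exact MeasurableSpace.measurableSet_generateFrom ht
  rw [trim_measurableSet_eq hle (MeasurableSet.symmDiff htm hA)] at htA
  obtain ⟨Q, K, hQ, htQ⟩ := exists_mem_sigmaSets_translatedPartition h𝓕.isSetAlgebra ht
  refine ⟨Q, K, hQ, t, htQ, ?_⟩
  rw [measureReal_def]
  refine ENNReal.toReal_lt_of_lt_ofReal (lt_of_le_of_lt ?_ htA)
  calc μ (B ∆ t) ≤ μ (B ∆ A) + μ (A ∆ t) := measure_symmDiff_le B A t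
    _ = μ (t ∆ A) := by rw [symmDiff_comm B A, hAB, zero_add, symmDiff_comm]

theorem IsGenerating.exists_approx_finset (h𝓕 : IsGenerating π μ 𝓕)
    (hπ : IsPMPClassBijectiveExtension π μ ν) (S : Finset (Set (UnitSpace G)))
    (hS : ∀ B ∈ S, MeasurableSet B) {Q₀ : Finpartition (univ : Set (UnitSpace G))}
    (hQ₀ : (Q₀.parts : Set (Set (UnitSpace G))) ⊆ 𝓕) {ε : ℝ} (hε : 0 < ε) :
    ∃ (Q : Finpartition (univ : Set (UnitSpace G))) (K : Finset (PartialAut H)),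
      (Q.parts : Set (Set (UnitSpace G))) ⊆ 𝓕 ∧ Q ≤ Q₀ ∧
        ∀ B ∈ S, ∃ A ∈ sigmaSets (translatedPartition π Q K), μ.real (B ∆ A) < ε := by
  classical
  induction S using Finset.induction_on with
  | empty => exact ⟨Q₀, ∅, hQ₀, le_rfl, by simp⟩
  | insert B S _ ih =>
    obtain ⟨Q, K, hQ, hQQ₀, h⟩ := ih fun B hB => hS B (Finset.mem_insert_of_mem hB)
    obtain ⟨Q', K', hQ', A, hA, hBA⟩ :=
      h𝓕.exists_approx hπ (hS B (Finset.mem_insert_self _ _)) hε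
    obtain ⟨R, hRQ, hRQ', hR⟩ := exists_common_refinement h𝓕.isSetAlgebra hQ hQ'
    refine ⟨R, K ∪ K', hR, hRQ.trans hQQ₀, fun C hC => ?_⟩
    rcases Finset.mem_insert.1 hC with rfl | hC
    · exact ⟨A, translatedPartition_mono hRQ' Finset.subset_union_right hA, hBA⟩
    · obtain ⟨A', hA', hCA'⟩ := h C hC
      exact ⟨A', translatedPartition_mono hRQ Finset.subset_union_left hA', hCA'⟩

/-- Lets the comparison for generating algebras also serve to pass to Borel refinements. -/
theorem IsPMPClassBijectiveExtension.isGenerating_borelSets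
    (hπ : IsPMPClassBijectiveExtension π μ ν) :
    IsGenerating π μ (borelSets (UnitSpace G)) where
  isSetAlgebra := isSetAlgebra_borelSets _
  subset_borel := subset_rfl
  generates := fun B hB =>
    ⟨B, MeasurableSpace.measurableSet_generateFrom ⟨1, B, hB, (hπ.act_one B).symm⟩, by simp⟩

/-- A map which is constant on the classes of `r`, preserves them, and preserves membership in the
sets of `S` at all points at which these agree with given unions of classes. -/
theorem exists_classwise_map {X : Type*} (r : Setoid X) (S : Set (Set X)) (a : Set X → Set X)
    (ha : ∀ B ∈ S, ∀ x y, r x y → x ∈ a B → y ∈ a B) :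
    ∃ τ : X → X, (∀ x, r x (τ x)) ∧ (∀ x y, r x y → τ x = τ y) ∧
      ∀ x, (∀ B ∈ S, x ∈ B ↔ x ∈ a B) → ∀ B ∈ S, x ∈ B ↔ τ x ∈ B := by
  -- Choose in each class, whenever possible, a point at which every B ∈ S agrees with its
  -- approximant.
  have hex : ∀ c : Quotient r, ∃ z, (Quotient.mk r z = c) ∧
      ((∃ z', Quotient.mk r z' = c ∧ ∀ B ∈ S, z' ∈ B ↔ z' ∈ a B) →
        ∀ B ∈ S, z ∈ B ↔ z ∈ a B) := by
    intro c
    by_cases h : ∃ z', Quotient.mk r z' = c ∧ ∀ B ∈ S, z' ∈ B ↔ z' ∈ a B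
    · obtain ⟨z, hz, hz'⟩ := h
      exact ⟨z, hz, fun _ => hz'⟩
    · obtain ⟨z, hz⟩ := Quotient.exists_rep c
      exact ⟨z, hz, fun h' => absurd h' h⟩
  choose t ht ht' using hex
  have hr : ∀ x, r x (t (Quotient.mk r x)) := fun x => r.symm (Quotient.exact (ht _))
  refine ⟨fun x => t (Quotient.mk r x), hr, fun x y hxy => ?_, fun x hx B hB => ?_⟩
  · exact congrArg t (Quotient.sound hxy)
  · rw [hx B hB, ht' _ ⟨x, rfl, hx⟩ B hB]
    exact ⟨ha B hB _ _ (hr x), ha B hB _ _ (r.symm (hr x))⟩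

/-- The equivalence relation `SameTranslates`. -/
def sameTranslatesSetoid (π : G → H) (P : Finpartition (univ : Set (UnitSpace G)))
    (K : Finset (PartialAut H)) : Setoid (UnitSpace G) where
  r := SameTranslates π P K
  iseqv := ⟨fun _ _ _ _ _ => Iff.rfl, SameTranslates.symm,
    fun h h' f hf A hA => (h f hf A hA).trans (h' f hf A hA)⟩

theorem mem_sigmaSets_act_translated (hπ : IsPMPClassBijectiveExtension π μ ν)
    {P : Finpartition (univ : Set (UnitSpace G))} {F K : Finset (PartialAut H)}
    {f : PartialAut H} (hf : f ∈ F) (hfK : ∀ k ∈ K, f * k ∈ F) {A : Set (UnitSpace G)}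
    (hA : A ∈ sigmaSets (translatedPartition π P K)) :
    act π f A ∈ sigmaSets (translatedPartition π P F) := by
  rw [mem_sigmaSets_translatedPartition] at hA ⊢
  intro x y hxy hx
  obtain ⟨g, hg, hgA, rfl⟩ := mem_setAct.1 hx
  obtain ⟨C, hC, hgC⟩ := exists_mem_parts P (src g)
  -- Since f itself is in F, lying in the range of π⁻¹(f) is visible to P^F, and y is the end of an
  -- arrow g' too.
  obtain ⟨g', hg', -, rfl⟩ := mem_setAct.1 ((hxy f hf C hC).1 (mem_setAct.2 ⟨g, hg, hgC, rfl⟩))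
  refine (hπ.rng_mem_act_iff hg').2 (hA _ _ (fun k hk B hB => ?_) hgA)
  rw [← hπ.rng_mem_act_iff hg, ← hπ.rng_mem_act_iff hg', ← hπ.act_mul]
  exact hxy _ (hfK k hk) B hB

/-- If the translates defining `P^F` are approximated by sets in the algebra of `P'^K` then good
homomorphisms for `P'` give rise to good homomorphisms for `P`. -/
theorem homCount_le_of_approx (hπ : IsPMPClassBijectiveExtension π μ ν)
    {P P' Q : Finpartition (univ : Set (UnitSpace G))} {F F' K : Finset (PartialAut H)}
    {δ δ' ε : ℝ} {d : ℕ} {σ : SoficMap H d}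
    (hP : ∀ C ∈ P.parts, MeasurableSet C) (hP' : ∀ C ∈ P'.parts, MeasurableSet C)
    (hPQ' : P' ≤ Q) (h1F : 1 ∈ F) (h1K : 1 ∈ K) (hKF : K ⊆ F') (hFF : F ⊆ F')
    (hFK : ∀ f ∈ F, ∀ k ∈ K, f * k ∈ F')
    (happ : ∀ f ∈ F, ∀ A ∈ P.parts, ∃ A' ∈ sigmaSets (translatedPartition π P' K),
      μ.real (act π f A ∆ A') < ε)
    (hσ : IsMultiplicative F' δ' σ)
    (h₁ : P.parts.card * ((3 * (K.card * P'.parts.card) + 1) * δ' +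
      (δ' + 2 * (F.card * P.parts.card * ε))) < δ)
    (h₂ : (translatedPartition π P F).parts.card * (δ' + F.card * P.parts.card * ε) < δ) :
    homCount π μ Q P' F' δ' σ ≤ homCount π μ Q P F δ σ := by
  classical
  have hprob := hπ.isPMP_left.isProbabilityMeasure
  -- Approximants are indexed by the set rather than by (f, A), with the whole space as a default
  -- elsewhere.
  have hchoice : ∀ B : Set (UnitSpace G), ∃ A' ∈ sigmaSets (translatedPartition π P' K),
      (∃ f ∈ F, ∃ A ∈ P.parts, B = act π f A) → μ.real (B ∆ A') < ε := by
    intro B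
    by_cases hB : ∃ f ∈ F, ∃ A ∈ P.parts, B = act π f A
    · obtain ⟨f, hf, A, hA, rfl⟩ := hB
      obtain ⟨A', hA', h⟩ := happ f hf A hA
      exact ⟨A', hA', fun _ => h⟩
    · exact ⟨univ, univ_mem_sigmaSets _, fun h => absurd h hB⟩
  choose a ha haε using hchoice
  obtain ⟨τ, hτ, hτ', hτS⟩ := exists_classwise_map (sameTranslatesSetoid π P' K)
    {B | ∃ f ∈ F, ∃ A ∈ P.parts, B = act π f A} a
    fun B _ => mem_sigmaSets_translatedPartition.1 (ha B)
  have hτK : ∀ D : Set (UnitSpace G), τ ⁻¹' D ∈ sigmaSets (translatedPartition π P' K) := by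
    intro D
    rw [mem_sigmaSets_translatedPartition]
    intro x y hxy hx
    rwa [mem_preimage, ← hτ' x y hxy]
  -- If x avoids all the approximation errors, then x and τ x lie in the same cell of P^F.
  have hτμ : ∀ D ∈ sigmaSets (translatedPartition π P F),
      μ.real (D ∆ (τ ⁻¹' D)) ≤ F.card * P.parts.card * ε := by
    intro D hD
    have hsub : D ∆ (τ ⁻¹' D) ⊆ ⋃ q ∈ F ×ˢ P.parts, act π q.1 q.2 ∆ a (act π q.1 q.2) := by
      intro x hx
      by_contra hxB
      have hsame : SameTranslates π P F x (τ x) := by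
        intro f hf A hA
        refine hτS x ?_ _ ⟨f, hf, A, hA, rfl⟩
        rintro _ ⟨g, hg, B, hB, rfl⟩
        have : x ∉ act π g B ∆ a (act π g B) := fun h' => hxB (mem_biUnion
          (s := ((F ×ˢ P.parts : Finset _) : Set (PartialAut H × Set (UnitSpace G))))
          (show (g, B) ∈ _ from Finset.mem_product.2 ⟨hg, hB⟩) h')
        rw [mem_symmDiff] at this
        tauto
      rw [mem_sigmaSets_translatedPartition] at hD
      have h₁ := hD _ _ hsame
      have h₂ := hD _ _ hsame.symm
      rw [mem_symmDiff, mem_preimage] at hx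
      tauto
    refine (measureReal_mono hsub (measure_ne_top _ _)).trans ((measureReal_biUnion_finset_le _ _).trans ?_)
    refine (Finset.sum_le_card_nsmul _ _ ε fun q hq => ?_).trans ?_
    · obtain ⟨hf, hA⟩ := Finset.mem_product.1 hq
      exact (haε _ ⟨q.1, hf, q.2, hA, rfl⟩).le
    · rw [Finset.card_product, nsmul_eq_mul, Nat.cast_mul]
  have hKF' : ∀ {A}, A ∈ sigmaSets (translatedPartition π P' K) →
      A ∈ sigmaSets (translatedPartition π P' F') := fun h =>
    translatedPartition_mono le_rfl hKF h
  have h1F' := hKF h1K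
  unfold homCount
  refine ENat.toENNReal_le.2 (encard_le_encard ?_)
  rintro _ ⟨φ, hφ, rfl⟩
  obtain ⟨Φ, hφΦ, hΦ⟩ := IsGoodHom.exists_pointMap hφ hπ h1F'
  -- The new homomorphism is induced by τ ∘ Φ. No measurability of τ is needed, as its preimages are
  -- finite unions of cells of P'^K.
  refine ⟨fun A => Φ ⁻¹' (τ ⁻¹' A), ⟨isHomOn_preimage _ (τ ∘ Φ), fun f hf => ?_, ?_⟩, ?_⟩
  · refine lt_of_le_of_lt (Finset.sum_le_card_nsmul _ _ ((3 * (K.card * P'.parts.card) + 1) * δ' +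
      (δ' + 2 * (F.card * P.parts.card * ε))) fun A hA => ?_) (by rwa [nsmul_eq_mul])
    have hA' := mem_sigmaSets_of_mem_parts hA
    have hfA := act_mem_sigmaSets (π := π) hf hA'
    have e₁ := hΦ.equivariant_translated hπ hσ (hFF hf) hKF (hFK f hf) (hτK A)
    have hmem : act π f (τ ⁻¹' A) ∆ (τ ⁻¹' act π f A) ∈
        sigmaSets (translatedPartition π P' F') :=
      symmDiff_mem_sigmaSets
        (mem_sigmaSets_act_translated hπ (hFF hf) (hFK f hf) (hτK A)) (hKF' (hτK _))
    have e₂ := (abs_lt.1 (hΦ.normCard_lt hπ hP' hmem)).2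
    have hτm : ∀ D, MeasurableSet (τ ⁻¹' D) := fun D =>
      measurableSet_of_mem_sigmaSets
        (fun C hC => hπ.measurableSet_parts_translatedPartition hP' hC) (hτK D)
    -- Compare both sets with f·A: acting by f does not increase measure, so each comparison costs
    -- one displacement by τ.
    have e₃ : μ.real (act π f (τ ⁻¹' A) ∆ (τ ⁻¹' act π f A)) ≤
        2 * (F.card * P.parts.card * ε) := by
      have i₁ := hπ.measureReal_act_symmDiff_le f (hτm A) (hP A hA)
      rw [symmDiff_comm] at i₁
      have i₂ := hτμ A (hπ.sigmaSets_subset h1F hA')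
      have i₃ := hτμ _ hfA
      have i₄ := measureReal_symmDiff_le (μ := μ) (s := act π f (τ ⁻¹' A)) (t := act π f A)
        (τ ⁻¹' act π f A)
      rw [symmDiff_comm (act π f (τ ⁻¹' A)) (act π f A)] at i₄
      rw [symmDiff_comm (τ ⁻¹' A) A] at i₁
      linarith
    have e₄ := normCard_symmDiff_le (d := d) (setAct (σ f).carrier (Φ ⁻¹' (τ ⁻¹' A)))
      (Φ ⁻¹' act π f (τ ⁻¹' A)) (Φ ⁻¹' (τ ⁻¹' act π f A))
    rw [preimage_symmDiff] at e₂
    linarith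
  · refine lt_of_le_of_lt (Finset.sum_le_card_nsmul _ _ (δ' + F.card * P.parts.card * ε)
      fun A hA => ?_) (by rwa [nsmul_eq_mul])
    have e₁ := hΦ.normCard_lt hπ hP' (hKF' (hτK A))
    have e₂ := hτμ A (mem_sigmaSets_of_mem_parts hA)
    have e₃ : |μ.real (τ ⁻¹' A) - μ.real A| ≤ μ.real (A ∆ (τ ⁻¹' A)) := by
      rw [symmDiff_comm]
      exact abs_measureReal_sub_le_measureReal_symmDiff'
        (measurableSet_of_mem_sigmaSets
          (fun C hC => hπ.measurableSet_parts_translatedPartition hP' hC) (hτK A)).nullMeasurableSet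
        (hπ.measurableSet_parts_translatedPartition hP hA).nullMeasurableSet
        (measure_ne_top _ _) (measure_ne_top _ _)
    have e₄ := abs_sub_le (normCard d (Φ ⁻¹' (τ ⁻¹' A))) (μ.real (τ ⁻¹' A)) (μ.real A)
    linarith
  · funext ⟨A, hA⟩
    -- Since 1 ∈ K and P' refines Q, members of Σ(Q) are unions of cells of P'^K, which τ preserves.
    have hA' := hπ.sigmaSets_subset (F := K) h1K (mem_sigmaSets_of_le hPQ' hA)
    change Φ ⁻¹' (τ ⁻¹' A) = φ A
    rw [hφΦ A (hKF' hA')]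
    ext y
    rw [mem_sigmaSets_translatedPartition] at hA'
    exact ⟨hA' _ _ (hτ (Φ y)).symm, hA' _ _ (hτ (Φ y))⟩

/-- The order of choice matters: ε is fixed first, the approximating P' and K depend on it and
determine M, and δ' comes last. With η = δ/(4(a+b+1)), each bracket is at most 3η. -/
theorem exists_tolerance {a b n δ : ℝ} (ha : 0 ≤ a) (hb : 0 ≤ b) (hn : 0 ≤ n) (hδ : 0 < δ) :
    ∃ ε : ℝ, 0 < ε ∧ ∀ M : ℝ, 1 ≤ M → ∀ δ₀ : ℝ, 0 < δ₀ → ∃ δ' : ℝ, 0 < δ' ∧ δ' ≤ δ₀ ∧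
      a * (M * δ' + (δ' + 2 * (n * ε))) < δ ∧ b * (δ' + n * ε) < δ := by
  have key : ∀ {c t : ℝ}, 0 ≤ c → c ≤ a + b → t ≤ 3 * (δ / (4 * (a + b + 1))) → c * t < δ := by
    intro c t hc hcab ht
    calc c * t ≤ c * (3 * (δ / (4 * (a + b + 1)))) := by gcongr
      _ ≤ (a + b + 1) * (3 * (δ / (4 * (a + b + 1)))) := by gcongr; linarith
      _ = 3 / 4 * δ := by field_simp
      _ < δ := by linarith
  have hη : 0 < δ / (4 * (a + b + 1)) := by positivity
  generalize δ / (4 * (a + b + 1)) = η at key hη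
  have hnε : n * (η / (n + 1)) ≤ η := by
    rw [← mul_div_assoc, div_le_iff₀ (by positivity)]
    nlinarith
  refine ⟨η / (n + 1), by positivity, fun M hM δ₀ hδ₀ => ?_⟩
  have hMη : M * min δ₀ (η / (2 * M)) ≤ η / 2 := by
    calc M * min δ₀ (η / (2 * M)) ≤ M * (η / (2 * M)) := by gcongr; exact min_le_right _ _
      _ = η / 2 := by field_simp
  have hpos : 0 < min δ₀ (η / (2 * M)) := lt_min hδ₀ (by positivity)
  have hδη : min δ₀ (η / (2 * M)) ≤ η / 2 := by nlinarith
  exact ⟨min δ₀ (η / (2 * M)), hpos, min_le_left _ _, key ha (by linarith) (by linarith),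
    key hb (by linarith) (by linarith)⟩

/-- The extra data Q₀, F₀ and δ₀ leave room to make P', F' and δ' as fine as a later estimate
requires. -/
theorem IsGenerating.exists_homCount_le (h𝓕 : IsGenerating π μ 𝓕)
    (hπ : IsPMPClassBijectiveExtension π μ ν)
    {P Q Q₀ : Finpartition (univ : Set (UnitSpace G))}
    (hP : ∀ C ∈ P.parts, MeasurableSet C)
    (hQ : (Q.parts : Set (Set (UnitSpace G))) ⊆ 𝓕)
    (hQ₀ : (Q₀.parts : Set (Set (UnitSpace G))) ⊆ 𝓕)
    {F : Finset (PartialAut H)} (h1 : 1 ∈ F) (F₀ : Finset (PartialAut H))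
    {δ δ₀ : ℝ} (hδ : 0 < δ) (hδ₀ : 0 < δ₀) :
    ∃ (P' : Finpartition (univ : Set (UnitSpace G))) (F' : Finset (PartialAut H)) (δ' : ℝ),
      (P'.parts : Set (Set (UnitSpace G))) ⊆ 𝓕 ∧ P' ≤ Q ∧ P' ≤ Q₀ ∧ 1 ∈ F' ∧ F₀ ⊆ F' ∧
      0 < δ' ∧ δ' ≤ δ₀ ∧ ∀ (d : ℕ) (σ : SoficMap H d), IsMultiplicative F' δ' σ →
        homCount π μ Q P' F' δ' σ ≤ homCount π μ Q P F δ σ := by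
  classical
  obtain ⟨R, hRQ, hRQ₀, hR⟩ := exists_common_refinement h𝓕.isSetAlgebra hQ hQ₀
  obtain ⟨ε, hεpos, htol⟩ := exists_tolerance (a := P.parts.card)
    (b := (translatedPartition π P F).parts.card) (n := F.card * P.parts.card)
    (by positivity) (by positivity) (by positivity) hδ
  obtain ⟨P', K, hP'𝓕, hP'R, happ⟩ := h𝓕.exists_approx_finset hπ
    ((F ×ˢ P.parts).image fun q => act π q.1 q.2) (by
      intro B hB
      obtain ⟨⟨f, A⟩, hfA, rfl⟩ := Finset.mem_image.1 hB
      exact hπ.measurableSet_act f (hP A (Finset.mem_product.1 hfA).2)) hR hεpos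
  set K' := insert 1 K with hK'
  obtain ⟨δ', hδ'pos, hδ'δ₀, h₁, h₂⟩ := htol (3 * (K'.card * P'.parts.card) + 1)
    (le_add_of_nonneg_left (by positivity)) δ₀ hδ₀
  -- The products f k are adjoined because multiplicativity and equivariance are applied to them.
  refine ⟨P', F₀ ∪ F ∪ K' ∪ Finset.image₂ (· * ·) F K', δ', hP'𝓕, hP'R.trans hRQ,
    hP'R.trans hRQ₀, ?_, ?_, hδ'pos, hδ'δ₀, fun d σ hσ => ?_⟩
  · simp [hK']
  · intro f hf
    simp [hf]
  · refine homCount_le_of_approx (K := K') (ε := ε) hπ hP (fun C hC => h𝓕.subset_borel (hP'𝓕 hC))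
      (hP'R.trans hRQ) h1 (Finset.mem_insert_self _ _) ?_ ?_ ?_ ?_ hσ ?_ ?_
    · intro f hf
      simp only [Finset.mem_union]
      exact Or.inl (Or.inr hf)
    · intro f hf
      simp only [Finset.mem_union]
      exact Or.inl (Or.inl (Or.inr hf))
    · intro f hf k hk
      exact Finset.mem_union_right _ (Finset.mem_image₂_of_mem hf hk)
    · intro f hf A hA
      obtain ⟨A', hA', h⟩ := happ (act π f A)
        (Finset.mem_image.2 ⟨(f, A), Finset.mem_product.2 ⟨hf, hA⟩, rfl⟩)
      exact ⟨A', translatedPartition_mono le_rfl (Finset.subset_insert _ _) hA', h⟩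
    · exact h₁
    · exact h₂

end Approximation

/-! ### Counting in Hamming balls -/

/-- An exponential Markov bound: the weights exp(-c|s|) over all subsets s sum to (1 + exp(-c))^n ≤
exp(κn/2), while a subset with |s| ≤ ηn has weight at least exp(-cηn) = exp(-κn/2). -/
theorem exists_card_hamming_ball_le {κ : ℝ} (hκ : 0 < κ) :
    ∃ η : ℝ, 0 < η ∧ ∀ {Y : Type} [Finite Y] (B₀ : Set Y),
      ({B : Set Y | normCard (Nat.card Y) (B ∆ B₀) ≤ η}.ncard : ℝ) ≤
        Real.exp (κ * Nat.card Y) := by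
  classical
  set c : ℝ := max 1 (-Real.log (κ / 2)) with hc
  have hc1 : 1 ≤ c := le_max_left _ _
  have hcκ : Real.exp (-c) ≤ κ / 2 := by
    rw [← Real.le_log_iff_exp_le (by positivity)]
    linarith [le_max_right 1 (-Real.log (κ / 2))]
  refine ⟨κ / (2 * c), by positivity, fun {Y} _ B₀ => ?_⟩
  have := Fintype.ofFinite Y
  rw [Nat.card_eq_fintype_card]
  set n := Fintype.card Y
  set η := κ / (2 * c) with hη
  have hηpos : 0 < η := by positivity
  have hcη : c * η = κ / 2 := by rw [hη]; field_simp
  set S : Finset (Finset Y) := Finset.univ.filter fun s => (s.card : ℝ) ≤ η * n with hS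
  have h₁ : {B : Set Y | normCard n (B ∆ B₀) ≤ η}.ncard ≤ S.card := by
    rw [← ncard_coe_finset]
    refine ncard_le_ncard_of_injOn (fun B => (B ∆ B₀).toFinset) (fun B hB => ?_) ?_
    · simp only [hS, Finset.coe_filter, Finset.mem_univ, true_and, mem_ofPred_eq]
      rw [← ncard_eq_toFinset_card']
      -- For n = 0 the normalized count is 0 by the convention for division by zero, so the
      -- hypothesis says nothing and emptiness of Y is used.
      rcases Nat.eq_zero_or_pos n with hn | hn
      · have : IsEmpty Y := Fintype.card_eq_zero_iff.1 hn
        rw [eq_empty_of_isEmpty (B ∆ B₀)]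
        simp only [ncard_empty, Nat.cast_zero]
        positivity
      · rw [mem_ofPred_eq, normCard, div_le_iff₀ (by exact_mod_cast hn)] at hB
        exact hB
    · intro B _ B' _ h
      exact symmDiff_left_injective B₀ (toFinset_inj.1 h)
  have h₂ : (S.card : ℝ) * Real.exp (-(c * η * n)) ≤ Real.exp (κ / 2 * n) := by
    calc (S.card : ℝ) * Real.exp (-(c * η * n)) = ∑ s ∈ S, Real.exp (-(c * η * n)) := by
          rw [Finset.sum_const, nsmul_eq_mul]
      _ ≤ ∑ s ∈ S, Real.exp (-c) ^ s.card := by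
          refine Finset.sum_le_sum fun s hs => ?_
          rw [← Real.exp_nat_mul]
          have := (Finset.mem_filter.1 hs).2
          refine Real.exp_le_exp.2 ?_
          nlinarith
      _ ≤ ∑ s : Finset Y, Real.exp (-c) ^ s.card :=
          Finset.sum_le_sum_of_subset_of_nonneg (Finset.filter_subset _ _)
            fun _ _ _ => by positivity
      _ = (Real.exp (-c) + 1) ^ n := by
          rw [← Fintype.sum_pow_mul_eq_add_pow Y]
          simp
      _ ≤ Real.exp (κ / 2) ^ n := by
          gcongr
          linarith [Real.add_one_le_exp (κ / 2)]
      _ = Real.exp (κ / 2 * n) := by rw [← Real.exp_nat_mul, mul_comm]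
  have h₃ : (S.card : ℝ) ≤ Real.exp (κ * n) := by
    rw [hcη] at h₂
    calc (S.card : ℝ) = S.card * Real.exp (-(κ / 2 * n)) * Real.exp (κ / 2 * n) := by
          rw [mul_assoc, ← Real.exp_add, neg_add_cancel, Real.exp_zero, mul_one]
      _ ≤ Real.exp (κ / 2 * n) * Real.exp (κ / 2 * n) := by gcongr
      _ = Real.exp (κ * n) := by rw [← Real.exp_add]; ring_nf
  exact (Nat.cast_le.2 h₁).trans h₃

theorem natCard_unitSpace_fullGroupoid (d : ℕ) : Nat.card (UnitSpace (FullGroupoid d)) = d := by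
  have e : UnitSpace (FullGroupoid d) ≃ Fin d :=
    { toFun := fun x => x.1.1
      invFun := fun i => ⟨(i, i), rfl⟩
      left_inv := fun x => Subtype.ext (Prod.ext rfl x.2)
      right_inv := fun _ => rfl }
  rw [Nat.card_congr e, Nat.card_fin]

/-- If every fibre of `s` on `Z` has at most `N` images under `r` then `r` takes at most `N` times
as many values on `Z` as `s`. -/
theorem encard_image_le_mul {α β γ : Type*} {Z : Set α} {r : α → β} {s : α → γ} {N : ℕ∞}
    (hs : (s '' Z).Finite) (h : ∀ a ∈ Z, (r '' {b ∈ Z | s b = s a}).encard ≤ N) :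
    (r '' Z).encard ≤ N * (s '' Z).encard := by
  have hsub : r '' Z ⊆ ⋃ t ∈ hs.toFinset, r '' {b ∈ Z | s b = t} := by
    rintro _ ⟨a, ha, rfl⟩
    exact mem_biUnion (s := (hs.toFinset : Set γ)) (x := s a)
      (by simpa using ⟨a, ha, rfl⟩) ⟨a, ⟨ha, rfl⟩, rfl⟩
  calc (r '' Z).encard ≤ ∑ t ∈ hs.toFinset, (r '' {b ∈ Z | s b = t}).encard :=
        (encard_le_encard hsub).trans (Finset.set_encard_biUnion_le _ _)
    _ ≤ hs.toFinset.card • N := by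
        refine Finset.sum_le_card_nsmul _ _ _ fun t ht => ?_
        obtain ⟨a, ha, rfl⟩ := hs.mem_toFinset.1 ht
        exact h a ha
    _ = N * (s '' Z).encard := by
        rw [hs.encard_eq_coe_toFinset_card, nsmul_eq_mul, mul_comm]

/-! ### Counting the restrictions to Σ(Q) that extend a given restriction to Σ(Q') -/

section Counting

variable {G H : Type*} [MeasurableSpace G] [DiscreteMeasurableGroupoid G] [MeasurableSpace H]
  [DiscreteMeasurableGroupoid H] {μ : Measure (UnitSpace G)} {ν : Measure (UnitSpace H)}
  {π : G → H}

/-- Homomorphisms agreeing on Σ(Q') nearly agree on Σ(Q'^K), hence on Σ(Q) by approximation. Each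
fibre thus lies in a product of |Σ(Q)| Hamming balls of radius η. -/
theorem homCount_le_exp_mul (hπ : IsPMPClassBijectiveExtension π μ ν)
    {P Q Q' : Finpartition (univ : Set (UnitSpace G))} {F K : Finset (PartialAut H)}
    {δ ε κ η : ℝ} {d : ℕ} {σ : SoficMap H d}
    (hP : ∀ C ∈ P.parts, MeasurableSet C) (hPQ : P ≤ Q) (hPQ' : P ≤ Q')
    (h1 : 1 ∈ F) (hKF : K ⊆ F)
    (happ : ∀ B ∈ sigmaSets Q, ∃ A ∈ sigmaSets (translatedPartition π Q' K), μ.real (B ∆ A) < ε)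
    (hη : ∀ B₀ : Set (UnitSpace (FullGroupoid d)),
      ({B | normCard d (B ∆ B₀) ≤ η}.ncard : ℝ) ≤ Real.exp (κ * d))
    (hδ : 2 * (ε + δ) + 2 * (K.card * Q'.parts.card) * δ ≤ η) :
    homCount π μ Q P F δ σ ≤
      ENNReal.ofReal (Real.exp ((sigmaSets Q).ncard * κ * d)) * homCount π μ Q' P F δ σ := by
  classical
  have := (finite_sigmaSets Q).to_subtype
  have := (finite_sigmaSets Q').to_subtype
  have := Fintype.ofFinite (sigmaSets Q)
  set Z := {φ : Set (UnitSpace G) → Set (UnitSpace (FullGroupoid d)) | IsGoodHom π μ σ P F δ φ}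
  have hclose : ∀ φ ∈ Z, ∀ φ' ∈ Z,
      (sigmaSets Q').domRestrict φ = (sigmaSets Q').domRestrict φ' →
      ∀ B ∈ sigmaSets Q, normCard d (φ B ∆ φ' B) ≤ η := by
    intro φ hφ φ' hφ' heq B hB
    obtain ⟨A, hA, hBA⟩ := happ B hB
    obtain ⟨Φ, hφΦ, hΦ⟩ := IsGoodHom.exists_pointMap hφ hπ h1
    obtain ⟨Φ', hφΦ', hΦ'⟩ := IsGoodHom.exists_pointMap hφ' hπ h1
    have hB' := hπ.sigmaSets_subset h1 (mem_sigmaSets_of_le hPQ hB)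
    have hA' := translatedPartition_mono hPQ' hKF hA
    have heq' : ∀ C ∈ sigmaSets Q', Φ ⁻¹' C = Φ' ⁻¹' C := by
      intro C hC
      have hC' := hπ.sigmaSets_subset h1 (mem_sigmaSets_of_le hPQ' hC)
      rw [← hφΦ C hC', ← hφΦ' C hC']
      exact congrFun heq ⟨C, hC⟩
    -- A good homomorphism nearly preserves measure, so the approximation error B ∆ A has image of
    -- density below ε + δ.
    have e₁ := (abs_lt.1 (hΦ.normCard_lt hπ hP (symmDiff_mem_sigmaSets hB' hA'))).2
    have e₂ := (abs_lt.1 (hΦ'.normCard_lt hπ hP (symmDiff_mem_sigmaSets hB' hA'))).2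
    have e₃ := hΦ.normCard_symmDiff_le_of_eq hΦ' hPQ' hKF heq' hA
    have e₄ := normCard_symmDiff_le (d := d) (Φ ⁻¹' B) (Φ ⁻¹' A) (Φ' ⁻¹' B)
    have e₅ := normCard_symmDiff_le (d := d) (Φ ⁻¹' A) (Φ' ⁻¹' A) (Φ' ⁻¹' B)
    rw [preimage_symmDiff] at e₁ e₂
    rw [symmDiff_comm (Φ' ⁻¹' A) (Φ' ⁻¹' B)] at e₅
    rw [hφΦ B hB', hφΦ' B hB']
    linarith
  have hfib : ∀ φ ∈ Z, ((sigmaSets Q).domRestrict '' {φ' ∈ Z |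
      (sigmaSets Q').domRestrict φ' = (sigmaSets Q').domRestrict φ}).encard ≤
      (⌊Real.exp ((sigmaSets Q).ncard * κ * d)⌋₊ : ℕ∞) := by
    intro φ hφ
    set T : Set (sigmaSets Q → Set (UnitSpace (FullGroupoid d))) :=
      univ.pi fun B => {D | normCard d (D ∆ φ B) ≤ η} with hT
    have hsub : (sigmaSets Q).domRestrict '' {φ' ∈ Z |
        (sigmaSets Q').domRestrict φ' = (sigmaSets Q').domRestrict φ} ⊆ T := by
      rintro _ ⟨φ', ⟨hφ', heq⟩, rfl⟩ B _
      exact hclose φ' hφ' φ hφ heq B B.2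
    have hTcard : (T.ncard : ℝ) ≤ Real.exp ((sigmaSets Q).ncard * κ * d) := by
      rw [← Nat.card_coe_set_eq, Nat.card_congr (Equiv.Set.univPi _), Nat.card_pi,
        Nat.cast_prod]
      calc ∏ B : sigmaSets Q, (Nat.card {D | normCard d (D ∆ φ B) ≤ η} : ℝ)
          ≤ ∏ B : sigmaSets Q, Real.exp (κ * d) :=
            Finset.prod_le_prod (fun _ _ => Nat.cast_nonneg _) fun B _ => hη (φ B)
        _ = Real.exp ((sigmaSets Q).ncard * κ * d) := by
            rw [Finset.prod_const, Finset.card_univ, ← Nat.card_eq_fintype_card,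
              Nat.card_coe_set_eq, ← Real.exp_nat_mul, mul_assoc]
    refine (encard_le_encard hsub).trans ?_
    rw [← (toFinite T).cast_ncard_eq]
    exact_mod_cast Nat.le_floor hTcard
  have hle := ENat.toENNReal_le.2 (encard_image_le_mul (toFinite _) hfib)
  rw [ENat.toENNReal_mul, ENat.toENNReal_coe] at hle
  refine hle.trans (mul_le_mul_left ?_ _)
  rw [← ENNReal.ofReal_natCast]
  exact ENNReal.ofReal_le_ofReal (Nat.floor_le (Real.exp_pos _).le)

end Counting

/-! ### Limits along a bias -/

section Bias

variable {J : Type*} [Preorder J]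

/-- In the ultrafilter case the limit exists because `EReal` is compact, and containing all tails
makes the ultrafilter finer than `atTop`. -/
theorem Bias.lim_mono (β : Bias J) {Φ Ψ : J → EReal} (h : ∀ᶠ j in atTop, Φ j ≤ Ψ j) :
    β.lim Φ ≤ β.lim Ψ := by
  cases β with
  | minus => exact liminf_le_liminf h
  | plus => exact limsup_le_limsup h
  | ultra β hβ =>
    have hle : (β : Filter J) ≤ atTop := le_iInf fun j => le_principal_iff.2 (hβ j)
    exact le_of_tendsto_of_tendsto (b := (β : Filter J)) (β.map Φ).le_nhds_lim
      (β.map Ψ).le_nhds_lim (hle h)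

theorem continuous_ereal_add_coe (κ : ℝ) : Continuous fun x : EReal => x + κ :=
  continuous_iff_continuousAt.2 fun _ =>
    ContinuousAt.comp (f := fun y : EReal => (y, (κ : EReal)))
      (EReal.continuousAt_add (Or.inr (EReal.coe_ne_bot κ)) (Or.inr (EReal.coe_ne_top κ)))
      (continuous_id.prodMk continuous_const).continuousAt

theorem Bias.lim_add_const [IsDirectedOrder J] [Nonempty J] (β : Bias J) (Φ : J → EReal) (κ : ℝ) :
    β.lim (fun j => Φ j + κ) = β.lim Φ + κ := by
  have hmono : Monotone fun x : EReal => x + κ := fun x y h => add_le_add_left h _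
  have hcont := continuous_ereal_add_coe κ
  cases β with
  | minus => exact (hmono.map_liminf_of_continuousAt Φ hcont.continuousAt).symm
  | plus => exact (hmono.map_limsup_of_continuousAt Φ hcont.continuousAt).symm
  | ultra β hβ =>
    refine tendsto_nhds_unique (f := fun j => Φ j + (κ : EReal)) (l := (β : Filter J))
      (β.map fun j => Φ j + (κ : EReal)).le_nhds_lim ?_
    exact (hcont.tendsto _).comp (β.map Φ).le_nhds_lim

end Bias

theorem ereal_le_of_forall_pos_le_add {a b : EReal} (h : ∀ κ : ℝ, 0 < κ → a ≤ b + κ) : a ≤ b := by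
  induction b with
  | bot => simpa using h 1 one_pos
  | top => exact le_top
  | coe b =>
    refine EReal.le_of_forall_lt_iff_le.1 fun z hz => ?_
    have := h (z - b) (sub_pos.2 (by exact_mod_cast hz))
    rwa [← EReal.coe_add, add_sub_cancel] at this

/-! ### Comparison of entropies -/

section Comparison

variable {G H J : Type*} [MeasurableSpace G] [DiscreteMeasurableGroupoid G] [MeasurableSpace H]
  [DiscreteMeasurableGroupoid H] {μ : Measure (UnitSpace G)} {ν : Measure (UnitSpace H)}
  {π : G → H} [Preorder J] {d : J → ℕ}
  {ℙ : ∀ j, Measure (SoficMap H (d j))} {p : ℝ≥0∞} {β : Bias J}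

theorem log_eLpNorm_div_le {Ω : Type*} [MeasurableSpace Ω] {P : Measure Ω} {f g : Ω → ℝ≥0∞}
    {n : ℕ} (hn : 0 < n) {κ : ℝ}
    (h : ∀ᵐ ω ∂P, f ω ≤ ENNReal.ofReal (Real.exp (κ * n)) * g ω) :
    ENNReal.log (eLpNorm f p P) / (n : EReal) ≤ ENNReal.log (eLpNorm g p P) / (n : EReal) + κ := by
  have h₁ : eLpNorm f p P ≤ ENNReal.ofReal (Real.exp (κ * n)) * eLpNorm g p P :=
    eLpNorm_le_mul_eLpNorm_of_ae_le_mul' h p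
  have h₂ := ENNReal.log_monotone h₁
  rw [ENNReal.log_mul_add, ENNReal.log_ofReal_of_pos (Real.exp_pos _), Real.log_exp] at h₂
  have hn0 : (0 : EReal) ≤ (n : EReal) := by exact_mod_cast n.zero_le
  refine (EReal.div_le_div_right_of_nonneg hn0 h₂).trans_eq ?_
  rw [EReal.add_div_of_nonneg_right hn0, add_comm]
  congr 1
  have : (n : ℝ) ≠ 0 := by exact_mod_cast hn.ne'
  rw [show (n : EReal) = ((n : ℝ) : EReal) from rfl, ← EReal.coe_div]
  congr 1
  field_simp

/-- For all large j almost every σ is multiplicative, so a pointwise comparison on such σ passes to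
the L^p norms; the factor exp(κn) becomes the summand κ. -/
theorem entropyFinite_le_add [IsDirectedOrder J] [Nonempty J]
    (hℙ : IsSoficApproximation ν d ℙ)
    {Q Q' P P' : Finpartition (univ : Set (UnitSpace G))} {F F' : Finset (PartialAut H)}
    {δ δ' κ : ℝ} (F₀ : Finset (PartialAut H)) {δ₀ : ℝ} (hδ₀ : 0 < δ₀)
    (h : ∀ (n : ℕ) (σ : SoficMap H n), IsMultiplicative F₀ δ₀ σ → homCount π μ Q P F δ σ ≤
      ENNReal.ofReal (Real.exp (κ * n)) * homCount π μ Q' P' F' δ' σ) :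
    entropyFinite d ℙ p β π μ Q P F δ ≤ entropyFinite d ℙ p β π μ Q' P' F' δ' + κ := by
  unfold entropyFinite
  rw [← Bias.lim_add_const]
  refine β.lim_mono ?_
  obtain ⟨j₀, hj₀⟩ := hℙ.multiplicative F₀ δ₀ hδ₀
  filter_upwards [eventually_ge_atTop j₀, hℙ.tendsto_size.eventually_gt_atTop 0] with j hj hdj
  exact log_eLpNorm_div_le hdj ((hj₀ j hj).mono fun σ hσ => h (d j) σ hσ)

theorem entropyPartition_le {𝓕 : Set (Set (UnitSpace G))}
    {Q P : Finpartition (univ : Set (UnitSpace G))} (hPQ : P ≤ Q)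
    (hP : (P.parts : Set (Set (UnitSpace G))) ⊆ 𝓕) {F : Finset (PartialAut H)} (h1 : 1 ∈ F)
    {δ : ℝ} (hδ : 0 < δ) :
    entropyPartition d ℙ p β π μ Q 𝓕 ≤ entropyFinite d ℙ p β π μ Q P F δ :=
  (iInf_le_of_le P (iInf_le_of_le hPQ (iInf_le _ hP))).trans
    (iInf_le_of_le F (iInf_le_of_le h1 (iInf_le_of_le δ (iInf_le _ hδ))))

theorem le_entropyPartition {𝓕 : Set (Set (UnitSpace G))}
    {Q : Finpartition (univ : Set (UnitSpace G))} {a : EReal}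
    (h : ∀ P : Finpartition (univ : Set (UnitSpace G)), P ≤ Q →
      (P.parts : Set (Set (UnitSpace G))) ⊆ 𝓕 → ∀ F : Finset (PartialAut H), 1 ∈ F →
      ∀ δ : ℝ, 0 < δ → a ≤ entropyFinite d ℙ p β π μ Q P F δ) :
    a ≤ entropyPartition d ℙ p β π μ Q 𝓕 :=
  le_iInf fun P => le_iInf fun hPQ => le_iInf fun hP => le_iInf fun F => le_iInf fun h1 =>
    le_iInf fun δ => le_iInf fun hδ => h P hPQ hP F h1 δ hδ

theorem entropyPartition_le_entropyAlgebra {𝓕 : Set (Set (UnitSpace G))}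
    {Q : Finpartition (univ : Set (UnitSpace G))}
    (hQ : (Q.parts : Set (Set (UnitSpace G))) ⊆ 𝓕) :
    entropyPartition d ℙ p β π μ Q 𝓕 ≤ entropyAlgebra d ℙ p β π μ 𝓕 :=
  le_iSup₂_of_le Q hQ le_rfl

/-- For a partition in a generating algebra, the finer partitions can be taken in the algebra. -/
theorem IsGenerating.entropyPartition_le_borelSets
    [IsDirectedOrder J] [Nonempty J] {𝓕 : Set (Set (UnitSpace G))}
    (h𝓕 : IsGenerating π μ 𝓕) (hπ : IsPMPClassBijectiveExtension π μ ν)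
    (hℙ : IsSoficApproximation ν d ℙ) {Q : Finpartition (univ : Set (UnitSpace G))}
    (hQ : (Q.parts : Set (Set (UnitSpace G))) ⊆ 𝓕) :
    entropyPartition d ℙ p β π μ Q 𝓕 ≤
      entropyPartition d ℙ p β π μ Q (borelSets (UnitSpace G)) := by
  refine le_entropyPartition fun P _ hP F h1 δ hδ => ?_
  obtain ⟨P', F', δ', hP', hP'Q, -, h1', -, hδ', -, hle⟩ :=
    h𝓕.exists_homCount_le hπ (Q₀ := Q) (fun C hC => hP hC) hQ hQ h1 ∅ hδ hδ
  refine (entropyPartition_le hP'Q hP' h1' hδ').trans ?_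
  have := entropyFinite_le_add (p := p) (β := β) (κ := 0) hℙ F' hδ'
    fun n σ hσ => by simpa using hle n σ hσ
  simpa using this

/-- The entropy of a Borel partition is bounded by that of a generating algebra. -/
theorem IsGenerating.entropyPartition_borelSets_le
    [IsDirectedOrder J] [Nonempty J] {𝓕 : Set (Set (UnitSpace G))}
    (h𝓕 : IsGenerating π μ 𝓕) (hπ : IsPMPClassBijectiveExtension π μ ν)
    (hℙ : IsSoficApproximation ν d ℙ) {Q : Finpartition (univ : Set (UnitSpace G))}
    (hQ : (Q.parts : Set (Set (UnitSpace G))) ⊆ borelSets (UnitSpace G)) {κ : ℝ} (hκ : 0 < κ) :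
    entropyPartition d ℙ p β π μ Q (borelSets (UnitSpace G)) ≤
      entropyAlgebra d ℙ p β π μ 𝓕 + κ := by
  -- The exponent κ is shared among the |Σ(Q)| Hamming balls, each receiving κ/(s + 1).
  set s : ℝ := ((sigmaSets Q).ncard : ℝ) with hs
  have hs0 : 0 ≤ s := by positivity
  obtain ⟨η, hη, hball⟩ := exists_card_hamming_ball_le (κ := κ / (s + 1)) (by positivity)
  have hball' : ∀ (n : ℕ) (B₀ : Set (UnitSpace (FullGroupoid n))),
      ({B | normCard n (B ∆ B₀) ≤ η}.ncard : ℝ) ≤ Real.exp (κ / (s + 1) * n) := by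
    intro n B₀
    have := hball B₀
    rwa [natCard_unitSpace_fullGroupoid] at this
  have htriv := parts_generatedPartition_subset h𝓕.isSetAlgebra (S := ∅) (by simp)
  obtain ⟨Q', K, hQ', -, happ⟩ := h𝓕.exists_approx_finset hπ (finite_sigmaSets Q).toFinset
    (fun B hB => measurableSet_of_mem_sigmaSets (fun C hC => hQ hC)
      ((finite_sigmaSets Q).mem_toFinset.1 hB)) htriv (ε := η / 6) (by positivity)
  set n : ℝ := K.card * Q'.parts.card with hn
  have hn0 : 0 ≤ n := by positivity
  refine le_trans ?_ (add_le_add_left (entropyPartition_le_entropyAlgebra hQ') _)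
  -- Moving κ to the left leaves a bare infimum on the right, so one choice of P₀, F₀, δ₀ can be
  -- treated at a time.
  rw [← EReal.sub_le_iff_le_add (Or.inl (EReal.coe_ne_bot κ)) (Or.inl (EReal.coe_ne_top κ))]
  refine le_entropyPartition fun P₀ hP₀Q' hP₀ F₀ h1 δ₀ hδ₀ => ?_
  rw [EReal.sub_le_iff_le_add (Or.inl (EReal.coe_ne_bot κ)) (Or.inl (EReal.coe_ne_top κ))]
  obtain ⟨P, F, δ, hP, hPQ', hPQ, h1F, hKF, hδ, hδη, hle⟩ :=
    hπ.isGenerating_borelSets.exists_homCount_le hπ (Q := Q') (Q₀ := Q)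
      (fun C hC => h𝓕.subset_borel (hP₀ hC)) (hQ'.trans h𝓕.subset_borel) hQ h1 K hδ₀
      (δ₀ := η / (6 * (n + 1))) (by positivity)
  refine (entropyPartition_le hPQ hP h1F hδ).trans (entropyFinite_le_add hℙ F hδ ?_)
  intro m σ hσ
  have hnδ : (n + 1) * δ ≤ η / 6 := by
    calc (n + 1) * δ ≤ (n + 1) * (η / (6 * (n + 1))) := by gcongr
      _ = η / 6 := by field_simp
  refine (homCount_le_exp_mul (Q' := Q') (K := K) (ε := η / 6) (κ := κ / (s + 1)) (η := η) hπ
    (fun C hC => hP hC) hPQ hPQ' h1F hKF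
    (fun B hB => happ B ((finite_sigmaSets Q).mem_toFinset.2 hB)) (hball' m) ?_).trans ?_
  -- The approximation error contributes η/3 and the terms in δ at most η/3, within the radius η.
  · rw [← hn]
    nlinarith
  · refine mul_le_mul' (ENNReal.ofReal_le_ofReal (Real.exp_le_exp.2 ?_)) (hle m σ hσ)
    rw [← hs]
    gcongr
    rw [← mul_div_assoc, div_le_iff₀ (by positivity)]
    nlinarith

end Comparison

end SoficEntropy

theorem theorem7p5 {G H J : Type*}
    [MeasurableSpace G] [SoficEntropy.DiscreteMeasurableGroupoid G]
    [MeasurableSpace H] [SoficEntropy.DiscreteMeasurableGroupoid H]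
    (μ : Measure (SoficEntropy.UnitSpace G)) (ν : Measure (SoficEntropy.UnitSpace H))
    (π : G → H) (hπ : SoficEntropy.IsPMPClassBijectiveExtension π μ ν)
    [Preorder J] [IsDirectedOrder J] [Nonempty J]
    (d : J → ℕ) (ℙ : ∀ j, Measure (SoficEntropy.SoficMap H (d j)))
    (hℙ : SoficEntropy.IsSoficApproximation ν d ℙ)
    (p : ℝ≥0∞) (hp : 1 ≤ p) (β : SoficEntropy.Bias J)
    (𝓕 : Set (Set (SoficEntropy.UnitSpace G))) (h𝓕 : SoficEntropy.IsGenerating π μ 𝓕) :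
    SoficEntropy.entropy d ℙ p β π μ = SoficEntropy.entropyAlgebra d ℙ p β π μ 𝓕 := by
  apply le_antisymm
  · refine iSup₂_le fun Q hQ => SoficEntropy.ereal_le_of_forall_pos_le_add fun κ hκ =>
      h𝓕.entropyPartition_borelSets_le hπ hℙ hQ hκ
  · exact iSup₂_le fun Q hQ => (h𝓕.entropyPartition_le_borelSets hπ hℙ hQ).trans
      (SoficEntropy.entropyPartition_le_entropyAlgebra (hQ.trans h𝓕.subset_borel))
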